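/- Let $m,n,p,q\ge 0$, let $\mathcal U\subset\mathbb R^{m|n}$ and $\mathcal W\subset\mathbb R^{p|q}$ be superdomains, i.e. open sets $U\subset\mathbb R^m$ and $W\subset\mathbb R^p$ with the structure sheaves $\mathcal O_{\mathcal U}=\mathcal C^\infty_U\otimes\Lambda\mathbb R^n$ and $\mathcal O_{\mathcal W}=\mathcal C^\infty_W\otimes\Lambda\mathbb R^q$. A morphism $\psi$ of superdomains consists of a continuous map $\widetilde\psi$ of the underlying open sets and a parity-preserving homomorphism $\psi^*$ of sheaves of unital real superalgebras over it. Let $X=X_0+X_1$ be a (not necessarily homogeneous) super vector field on $\mathcal W$, i.e. the sum of an even and an odd derivation of the sheaf $\mathcal O_{\mathcal W}$, let $\phi:\mathcal U\to\mathcal W$ be a morphism, and let $t_0\in\mathbb R$. Let $\widetilde X$ be the reduced vector field on $W$, with components $\widetilde X(y_j)=\widetilde{X_0(y_j)}$, where $y_1,\dots,y_p$ are the even coordinates of $\mathcal W$ and $\widetilde g$ is the real function underlying a superfunction $g$. Let $H:V\to W$ be the maximal flow of $\widetilde X$ with initial condition $H(t_0,\cdot)=\widetilde\phi$: it is a smooth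 map on an open set $V\subset\mathbb R\times U$ which contains $\{t_0\}\times U$ and meets each line $\mathbb R\times\{x\}$, $x\in U$, in an open interval, it satisfies $\partial_tH=\widetilde X\circ H$, and $V$ contains the domain of every other such flow. Let $(t,\tau)$ be the canonical coordinates on $\mathbb R^{1|1}$, put $\mathcal V=(V,\mathcal O_{\mathbb R^{1|1}\times\mathcal U}|_V)$, let $\mathrm{inj}:(V,\mathcal O_{\mathbb R\times\mathcal U}|_V)\to\mathcal V$ be the natural injection (the identity on $V$, with $\mathrm{inj}^*\tau=0$), and let $\mathrm{inj}_{\{t_0\}\times\mathcal U}:\mathcal U\to\mathcal V$ be the natural injection at $t=t_0$, $\tau=0$. Then there is a unique morphism $F:\mathcal V\to\mathcal W$ such that $$\mathrm{inj}^*\circ(\partial_t+\partial_\tau)\circ F^*=\mathrm{inj}^*\circ F^*\circ X\qquad\text{and}\qquad F\circ\mathrm{inj}_{\{t_0\}\times\mathcal U}=\phi .$$ Moreover, the underlying map $\widetilde F:V\to W$ of $F$ equals the classical flow $H$. -/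

import Mathlib

open Set TopologicalSpace
open scoped ContDiff

namespace SuperFlow

noncomputable section

/-! ### The Grassmann algebra and its canonical topology -/

/-- The real Grassmann algebra `Λ ℝⁿ`; its odd generators are the images under
`ExteriorAlgebra.ι` of the standard basis vectors of `ℝⁿ`. -/
abbrev Gr (n : ℕ) : Type := ExteriorAlgebra ℝ (Fin n → ℝ)

/-- The basis of monomials in the odd generators. -/
def grBasis (n : ℕ) : Module.Basis (Finset (Fin n)) ℝ (Gr n) :=
  (Pi.basisFun ℝ (Fin n)).ExteriorAlgebra

/-- A norm on the finite-dimensional space `Λ ℝⁿ` (the maximum of the absolute values of the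
coefficients). Only its topology, which does not depend on the choice of a norm, is used. -/
instance grNormedAddCommGroup (n : ℕ) : NormedAddCommGroup (Gr n) :=
  NormedAddCommGroup.induced (Gr n) (Finset (Fin n) → ℝ) (grBasis n).equivFun
    (grBasis n).equivFun.injective

instance grNormedSpace (n : ℕ) : NormedSpace ℝ (Gr n) :=
  NormedSpace.induced ℝ (Gr n) (Finset (Fin n) → ℝ) (grBasis n).equivFun

instance grFiniteDimensional (n : ℕ) : FiniteDimensional ℝ (Gr n) :=
  Module.Basis.finiteDimensional_of_finite (grBasis n)

/-- The even (`i = 0`) and the odd (`i = 1`) part of the Grassmann algebra. -/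
def grPart (n : ℕ) (i : ZMod 2) : Submodule ℝ (Gr n) :=
  CliffordAlgebra.evenOdd (0 : QuadraticForm ℝ (Fin n → ℝ)) i

/-- The body (degree zero coefficient) of an element of the Grassmann algebra. -/
def grBody (n : ℕ) : Gr n →ₐ[ℝ] ℝ := ExteriorAlgebra.algebraMapInv

/-- Linear maps between Grassmann algebras are smooth. -/
theorem contDiff_gr_linearMap {n n' : ℕ} (L : Gr n →ₗ[ℝ] Gr n') : ContDiff ℝ ∞ L :=
  (LinearMap.toContinuousLinearMap L).contDiff

/-- The multiplication of the Grassmann algebra is smooth. -/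
theorem contDiff_gr_mul (n : ℕ) : ContDiff ℝ ∞ (fun z : Gr n × Gr n => z.1 * z.2) := by
  have h := (LinearMap.toContinuousLinearMap
    ((LinearMap.toContinuousLinearMap : (Gr n →ₗ[ℝ] Gr n) ≃ₗ[ℝ] (Gr n →L[ℝ] Gr n)).toLinearMap
      ∘ₗ LinearMap.mul ℝ (Gr n))).isBoundedBilinearMap
  exact h.contDiff

/-! ### Superfunctions -/

/-- The extension by zero of a function on an open set. -/
def ext0 {E : Type*} [TopologicalSpace E] {n : ℕ} {U : Opens E} (f : U → Gr n) : E → Gr n :=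
  Function.extend Subtype.val f 0

theorem ext0_apply {E : Type*} [TopologicalSpace E] {n : ℕ} {U : Opens E} (f : U → Gr n)
    {x : E} (hx : x ∈ U) : ext0 f x = f ⟨x, hx⟩ :=
  Subtype.val_injective.extend_apply f 0 ⟨x, hx⟩

section SuperFunctions

variable {E : Type*} [NormedAddCommGroup E] [NormedSpace ℝ E]

/-- The superalgebra of superfunctions on the superdomain with body the open set `U` of `E`
and `n` odd coordinates: the smooth functions on `U` with values in `Λ ℝⁿ`, i.e.
`C^∞(U) ⊗ Λ ℝⁿ`, with the pointwise operations. -/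
def SuperFun (n : ℕ) (U : Opens E) : Subalgebra ℝ (U → Gr n) where
  carrier := {f | ContDiffOn ℝ ∞ (ext0 f) U}
  mul_mem' := by
    intro f g hf hg
    refine ((contDiff_gr_mul n).comp_contDiffOn (hf.prodMk hg)).congr ?_
    intro x hx
    simp only [Function.comp_apply, ext0_apply _ hx, Pi.mul_apply]
  add_mem' := by
    intro f g hf hg
    refine (hf.add hg).congr ?_
    intro x hx
    simp only [Pi.add_apply, ext0_apply _ hx]
  algebraMap_mem' := by
    intro r
    refine (contDiffOn_const (c := algebraMap ℝ (Gr n) r)).congr ?_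
    intro x hx
    simp only [ext0_apply _ hx, Pi.algebraMap_apply]

/-- A superfunction is even (`i = 0`), respectively odd (`i = 1`). -/
def HasParity {n : ℕ} {U : Opens E} (i : ZMod 2) (f : SuperFun n U) : Prop :=
  ∀ x : U, f.1 x ∈ grPart n i

/-- The restriction maps of the structure sheaf. -/
def res {n : ℕ} {U₁ U₂ : Opens E} (h : U₁ ≤ U₂) : SuperFun n U₂ →ₐ[ℝ] SuperFun n U₁ where
  toFun f := ⟨fun x => f.1 ⟨x.1, h x.2⟩, by
    refine (f.2.mono h).congr ?_
    intro x hx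
    rw [ext0_apply _ hx, ext0_apply _ (h hx)]⟩
  map_one' := rfl
  map_mul' _ _ := rfl
  map_zero' := rfl
  map_add' _ _ := rfl
  commutes' _ := rfl

/-- A smooth real function, regarded as an (even) superfunction. -/
def ofSmooth {n : ℕ} {U : Opens E} (g : E → ℝ) (hg : ContDiffOn ℝ ∞ g U) : SuperFun n U :=
  ⟨fun x => algebraMap ℝ (Gr n) (g x), by
    refine (((Algebra.linearMap ℝ (Gr n)).toContinuousLinearMap.contDiff).comp_contDiffOn
      hg).congr ?_
    intro x hx
    rw [ext0_apply _ hx]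
    rfl⟩

/-- The derivative of a superfunction in a constant even direction `v`; it acts on the
coefficients of the monomials in the odd generators. -/
def evenDeriv {n : ℕ} {U : Opens E} (v : E) : SuperFun n U →ₗ[ℝ] SuperFun n U where
  toFun f := ⟨fun x => fderiv ℝ (ext0 f.1) x v, by
    refine ((f.2.fderiv_of_isOpen U.isOpen (m := ∞) le_rfl).clm_apply
      (contDiffOn_const (c := v))).congr ?_
    intro x hx
    rw [ext0_apply _ hx]⟩
  map_add' f g := by
    ext1
    funext x
    have e : ext0 (f + g).1 =ᶠ[nhds x.1] fun y => ext0 f.1 y + ext0 g.1 y := by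
      filter_upwards [U.isOpen.mem_nhds x.2] with y hy
      simp only [ext0_apply _ hy]
      rfl
    have hf : DifferentiableAt ℝ (ext0 f.1) x.1 :=
      (f.2.contDiffAt (U.isOpen.mem_nhds x.2)).differentiableAt (by simp)
    have hg : DifferentiableAt ℝ (ext0 g.1) x.1 :=
      (g.2.contDiffAt (U.isOpen.mem_nhds x.2)).differentiableAt (by simp)
    change fderiv ℝ (ext0 (f + g).1) x.1 v
      = fderiv ℝ (ext0 f.1) x.1 v + fderiv ℝ (ext0 g.1) x.1 v
    rw [e.fderiv_eq, fderiv_fun_add hf hg]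
    rfl
  map_smul' c f := by
    ext1
    funext x
    have e : ext0 (c • f).1 =ᶠ[nhds x.1] fun y => c • ext0 f.1 y := by
      filter_upwards [U.isOpen.mem_nhds x.2] with y hy
      simp only [ext0_apply _ hy]
      rfl
    have hf : DifferentiableAt ℝ (ext0 f.1) x.1 :=
      (f.2.contDiffAt (U.isOpen.mem_nhds x.2)).differentiableAt (by simp)
    change fderiv ℝ (ext0 (c • f).1) x.1 v = c • fderiv ℝ (ext0 f.1) x.1 v
    rw [e.fderiv_eq, fderiv_fun_const_smul hf]
    rfl

/-- The (left) derivative of a superfunction with respect to the odd coordinate number `r`: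
the odd derivation of the Grassmann algebra which sends the generator number `r` to `1` and
the other generators to `0`, applied pointwise. -/
def oddDeriv {n : ℕ} {U : Opens E} (r : Fin n) : SuperFun n U →ₗ[ℝ] SuperFun n U where
  toFun f := ⟨fun x => CliffordAlgebra.contractLeft (Q := (0 : QuadraticForm ℝ (Fin n → ℝ)))
      (LinearMap.proj r) (f.1 x), by
    refine ((contDiff_gr_linearMap (CliffordAlgebra.contractLeft
      (Q := (0 : QuadraticForm ℝ (Fin n → ℝ))) (LinearMap.proj r))).comp_contDiffOn
        f.2).congr ?_
    intro x hx
    rw [ext0_apply _ hx, Function.comp_apply, ext0_apply _ hx]⟩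
  map_add' f g := by
    ext1
    funext x
    exact map_add _ _ _
  map_smul' c f := by
    ext1
    funext x
    exact (CliffordAlgebra.contractLeft (Q := (0 : QuadraticForm ℝ (Fin n → ℝ)))
      (LinearMap.proj r)).map_smul c (f.1 x)

end SuperFunctions

/-! ### Morphisms of superdomains -/

/-- The preimage of an open set `O ⊆ W` under a continuous map `b : U → W`. -/
def preim {E E' : Type*} [TopologicalSpace E] [TopologicalSpace E']
    {U : Opens E} {W : Opens E'} (b : C(U, W)) (O : Opens E') : Opens E :=
  ⟨{x | ∃ h : x ∈ U, (b ⟨x, h⟩ : E') ∈ O}, by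
    have h1 : IsOpen {x : U | (b x : E') ∈ O} :=
      O.isOpen.preimage (continuous_subtype_val.comp b.continuous)
    have h2 := U.isOpen.isOpenMap_subtype_val _ h1
    convert h2 using 1
    ext x
    constructor
    · rintro ⟨h, hx⟩
      exact ⟨⟨x, h⟩, hx, rfl⟩
    · rintro ⟨y, hy, rfl⟩
      exact ⟨y.2, hy⟩⟩

theorem preim_le {E E' : Type*} [TopologicalSpace E] [TopologicalSpace E']
    {U : Opens E} {W : Opens E'} (b : C(U, W)) (O : Opens E') : preim b O ≤ U :=
  fun _ hx => hx.1

theorem preim_mono {E E' : Type*} [TopologicalSpace E] [TopologicalSpace E']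
    {U : Opens E} {W : Opens E'} (b : C(U, W)) {O₁ O₂ : Opens E'}
    (h : O₁ ≤ O₂) : preim b O₁ ≤ preim b O₂ :=
  fun _ hx => ⟨hx.1, h hx.2⟩

section Morphisms

variable {E E' E'' : Type*} [NormedAddCommGroup E] [NormedSpace ℝ E]
  [NormedAddCommGroup E'] [NormedSpace ℝ E'] [NormedAddCommGroup E''] [NormedSpace ℝ E'']

/-- A morphism from the superdomain with body `U` and `n` odd coordinates to the superdomain
with body `W` and `n'` odd coordinates: a continuous map of the bodies together with a
homomorphism of sheaves of (unital, real) superalgebras from the structure sheaf of the target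
to the direct image of the structure sheaf of the source. -/
@[ext]
structure SuperMor (n n' : ℕ) (U : Opens E) (W : Opens E') where
  /-- the underlying map of the bodies -/
  body : C(U, W)
  /-- the pull-back of superfunctions -/
  pull : ∀ O : Opens E', O ≤ W → (SuperFun n' O →ₐ[ℝ] SuperFun n (preim body O))
  /-- pull-backs preserve parities -/
  parity : ∀ (O : Opens E') (hO : O ≤ W) (i : ZMod 2) (f : SuperFun n' O),
    HasParity i f → HasParity i (pull O hO f)
  /-- pull-backs commute with restrictions -/
  natural : ∀ (O₁ O₂ : Opens E') (h₁ : O₁ ≤ W) (h₂ : O₂ ≤ W) (h : O₁ ≤ O₂)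
    (f : SuperFun n' O₂),
    res (preim_mono body h) (pull O₂ h₂ f) = pull O₁ h₁ (res h f)

/-- The composition `G ∘ F` of morphisms of superdomains. -/
def SuperMor.comp {n n' n'' : ℕ} {U : Opens E} {W : Opens E'} {Z : Opens E''}
    (G : SuperMor n' n'' W Z) (F : SuperMor n n' U W) : SuperMor n n'' U Z where
  body := G.body.comp F.body
  pull O hO :=
    (res (show preim (G.body.comp F.body) O ≤ preim F.body (preim G.body O) from
      fun _ hx => ⟨hx.1, (F.body ⟨_, hx.1⟩).2, hx.2⟩)).comp
      ((F.pull (preim G.body O) (preim_le G.body O)).comp (G.pull O hO))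
  parity O hO i f hf := by
    intro x
    exact F.parity (preim G.body O) (preim_le G.body O) i _ (G.parity O hO i f hf)
      ⟨x.1, x.2.1, (F.body ⟨x.1, x.2.1⟩).2, x.2.2⟩
  natural O₁ O₂ h₁ h₂ h f := by
    have hG := G.natural O₁ O₂ h₁ h₂ h f
    have hF := F.natural (preim G.body O₁) (preim G.body O₂) (preim_le G.body O₁)
      (preim_le G.body O₂) (preim_mono G.body h) (G.pull O₂ h₂ f)
    rw [hG] at hF
    ext1
    funext x
    exact congrArg (fun k : SuperFun n (preim F.body (preim G.body O₁)) =>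
      k.1 ⟨x.1, x.2.1, (F.body ⟨x.1, x.2.1⟩).2, x.2.2⟩) hF

/-- The morphism given on the bodies by a smooth map `g` and on the odd coordinates by a linear
map `L` with constant coefficients: `f ↦ (x ↦ Λ(L) (f (g x)))`. -/
def SuperMor.ofSplit {n n' : ℕ} {U : Opens E} {W : Opens E'} (g : E → E')
    (hg : ContDiffOn ℝ ∞ g U) (hUW : MapsTo g U W) (L : (Fin n' → ℝ) →ₗ[ℝ] (Fin n → ℝ)) :
    SuperMor n n' U W where
  body := ⟨fun x => ⟨g x, hUW x.2⟩,
    (continuousOn_iff_continuous_domRestrict.mp hg.continuousOn).subtype_mk _⟩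
  pull O _ :=
    { toFun := fun f => ⟨fun x => ExteriorAlgebra.map L (f.1 ⟨g x, x.2.2⟩), by
        have hs := (contDiff_gr_linearMap (ExteriorAlgebra.map L).toLinearMap).comp_contDiffOn
          (f.2.comp (hg.mono (fun _ hx => hx.1)) (fun _ hx => hx.2) :
            ContDiffOn ℝ ∞ (ext0 f.1 ∘ g) {x | ∃ _ : x ∈ U, g x ∈ O})
        refine hs.congr ?_
        intro x hx
        rw [ext0_apply _ hx]
        simp only [Function.comp_apply]
        rw [ext0_apply _ hx.2]
        rfl⟩
      map_one' := by
        ext1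
        funext x
        exact map_one _
      map_mul' := by
        intro f f'
        ext1
        funext x
        exact map_mul _ _ _
      map_zero' := by
        ext1
        funext x
        exact map_zero _
      map_add' := by
        intro f f'
        ext1
        funext x
        exact map_add _ _ _
      commutes' := by
        intro r
        ext1
        funext x
        exact AlgHom.commutes _ _ }
  parity O _ i f hf := by
    intro x
    have key : grPart n' i ≤ (grPart n i).comap (ExteriorAlgebra.map L).toLinearMap := by
      refine iSup_le fun j => ?_
      rw [← Submodule.map_le_iff_le_comap, Submodule.map_pow]
      refine le_trans ?_ (le_iSup (fun j : {k : ℕ // (k : ZMod 2) = i} =>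
        LinearMap.range (CliffordAlgebra.ι (0 : QuadraticForm ℝ (Fin n → ℝ))) ^ (j : ℕ)) j)
      refine pow_le_pow_left' ?_ _
      rintro _ ⟨_, ⟨v, rfl⟩, rfl⟩
      exact ⟨L v, (ExteriorAlgebra.map_apply_ι L v).symm⟩
    exact key (hf _)
  natural _ _ _ _ _ _ := rfl

end Morphisms

/-! ### Super vector fields -/

section VectorFields

variable {E : Type*} [NormedAddCommGroup E] [NormedSpace ℝ E]

/-- A homogeneous derivation of parity `i` of the structure sheaf of the superdomain with body
`W` and `n` odd coordinates. -/
structure SuperDer (n : ℕ) (i : ZMod 2) (W : Opens E) where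
  /-- the action on the superfunctions on an open subset -/
  app : ∀ O : Opens E, O ≤ W → (SuperFun n O →ₗ[ℝ] SuperFun n O)
  /-- the derivation shifts parities by `i` -/
  parity : ∀ (O : Opens E) (hO : O ≤ W) (j : ZMod 2) (f : SuperFun n O),
    HasParity j f → HasParity (i + j) (app O hO f)
  /-- the graded Leibniz rule -/
  leibniz : ∀ (O : Opens E) (hO : O ≤ W) (j : ZMod 2) (f g : SuperFun n O), HasParity j f →
    app O hO (f * g) = app O hO f * g + (-1 : ℝ) ^ (i.val * j.val) • (f * app O hO g)
  /-- compatibility with restrictions -/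
  natural : ∀ (O₁ O₂ : Opens E) (h₁ : O₁ ≤ W) (h₂ : O₂ ≤ W) (h : O₁ ≤ O₂) (f : SuperFun n O₂),
    res h (app O₂ h₂ f) = app O₁ h₁ (res h f)

/-- A (not necessarily homogeneous) super vector field `X = X₀ + X₁`. -/
structure SuperVectorField (n : ℕ) (W : Opens E) where
  /-- the even part `X₀` -/
  even : SuperDer n 0 W
  /-- the odd part `X₁` -/
  odd : SuperDer n 1 W

/-- The action of a super vector field on superfunctions. -/
def SuperVectorField.app {n : ℕ} {W : Opens E} (X : SuperVectorField n W) (O : Opens E)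
    (hO : O ≤ W) : SuperFun n O →ₗ[ℝ] SuperFun n O :=
  X.even.app O hO + X.odd.app O hO

end VectorFields

/-- The even coordinate function `y_j` on a superdomain in `ℝ^{p|q}`. -/
def evenCoord {p : ℕ} (q : ℕ) (W : Opens (Fin p → ℝ)) (j : Fin p) : SuperFun q W :=
  ofSmooth (fun y => y j) (contDiff_apply ℝ ℝ j).contDiffOn

/-- The reduced vector field `X̃` on the body: its component number `j` at `y` is
`X̃_y(y_j) = X₀(y_j)(y)`. (Its value outside `W` is irrelevant.) -/
def reducedField {p q : ℕ} {W : Opens (Fin p → ℝ)} (X : SuperVectorField q W) :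
    (Fin p → ℝ) → (Fin p → ℝ) :=
  fun y j => grBody q (ext0 (X.even.app W le_rfl (evenCoord q W j)).1 y)

/-! ### Classical flows -/

/-- `V` is a flow domain over `U` with respect to `t₀`, and `H` restricts to a smooth map
`V → W` which is a flow of the vector field `Y` on `W` with initial condition `b` at time `t₀`.
(Only the values of `H` on `V` matter.) -/
structure IsFlow {m p : ℕ} {U : Opens (Fin m → ℝ)} {W : Opens (Fin p → ℝ)}
    (Y : (Fin p → ℝ) → (Fin p → ℝ)) (b : C(U, W)) (t₀ : ℝ)
    (V : Opens (ℝ × (Fin m → ℝ))) (H : ℝ × (Fin m → ℝ) → (Fin p → ℝ)) : Prop where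
  mem_of_mem : ∀ v ∈ V, v.2 ∈ U
  initial_mem : ∀ x ∈ U, (t₀, x) ∈ V
  interval : ∀ x ∈ U, OrdConnected {t : ℝ | (t, x) ∈ V}
  mapsTo : MapsTo H V W
  smooth : ContDiffOn ℝ ∞ H V
  flow : ∀ t x, (t, x) ∈ V → HasDerivAt (fun s => H (s, x)) (Y (H (t, x))) t
  initial : ∀ x : U, H (t₀, x) = b x

/-- `(V, H)` is the maximal flow: its domain contains every other flow domain. -/
def IsMaximalFlow {m p : ℕ} {U : Opens (Fin m → ℝ)} {W : Opens (Fin p → ℝ)}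
    (Y : (Fin p → ℝ) → (Fin p → ℝ)) (b : C(U, W)) (t₀ : ℝ)
    (V : Opens (ℝ × (Fin m → ℝ))) (H : ℝ × (Fin m → ℝ) → (Fin p → ℝ)) : Prop :=
  IsFlow Y b t₀ V H ∧ ∀ V' H', IsFlow Y b t₀ V' H' → V' ≤ V

/-! ### The weakened flow equation

The superdomain `ℝ^{1|1} × 𝒰` has the coordinates `(t, x | τ, ξ)`: its body lies in `ℝ × ℝ^m`,
`τ` is the odd coordinate number `0`, and `ξ_r` is the odd coordinate number `r + 1`. -/

/-- The linear map on odd generators given by `τ ↦ 0`, `ξ_r ↦ ξ_r`. -/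
def killTau (n : ℕ) : (Fin (n + 1) → ℝ) →ₗ[ℝ] (Fin n → ℝ) :=
  LinearMap.funLeft ℝ ℝ Fin.succ

/-- The natural injection of `(V, 𝒪_{ℝ × 𝒰}|_V)` into `(V, 𝒪_{ℝ^{1|1} × 𝒰}|_V)`. -/
def injTau {m : ℕ} (n : ℕ) (V : Opens (ℝ × (Fin m → ℝ))) : SuperMor n (n + 1) V V :=
  SuperMor.ofSplit id contDiff_id.contDiffOn (mapsTo_id _) (killTau n)

/-- The natural injection of `{t₀} × 𝒰` into `(V, 𝒪_{ℝ^{1|1} × 𝒰}|_V)`. -/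
def injTime {m : ℕ} (n : ℕ) {U : Opens (Fin m → ℝ)} (V : Opens (ℝ × (Fin m → ℝ))) (t₀ : ℝ)
    (h : ∀ x ∈ U, (t₀, x) ∈ V) : SuperMor n (n + 1) U V :=
  SuperMor.ofSplit (fun x => (t₀, x)) (contDiff_const.prodMk contDiff_id).contDiffOn h (killTau n)

/-- The derivation `∂_t + ∂_τ` on the superfunctions on an open set in `ℝ^{1|1} × 𝒰`. -/
def derivTTau {m n : ℕ} (O : Opens (ℝ × (Fin m → ℝ))) :
    SuperFun (n + 1) O →ₗ[ℝ] SuperFun (n + 1) O :=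
  evenDeriv ((1 : ℝ), (0 : Fin m → ℝ)) + oddDeriv (0 : Fin (n + 1))

/-- `F : 𝒱 → 𝒲` solves the weakened flow equation
`inj^* ∘ (∂_t + ∂_τ) ∘ F^* = inj^* ∘ F^* ∘ X`, with `inj` the injection at `τ = 0`. -/
def SolvesFlowEq {m n p q : ℕ} {W : Opens (Fin p → ℝ)} (X : SuperVectorField q W)
    {V : Opens (ℝ × (Fin m → ℝ))} (F : SuperMor (n + 1) q V W) : Prop :=
  ∀ (O : Opens (Fin p → ℝ)) (hO : O ≤ W) (f : SuperFun q O),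
    (injTau n V).pull (preim F.body O) (preim_le F.body O) (derivTTau _ (F.pull O hO f)) =
      (injTau n V).pull (preim F.body O) (preim_le F.body O) (F.pull O hO (X.app O hO f))

end

end SuperFlow

/-! Write superfunctions on `𝒱` as a + τ d with a and d free of τ. A morphism F over a fixed map of
bodies is then the same thing as a pair (A, D): the morphism A = `F.kill` obtained at τ = 0, and the
coefficient D = `F.top` of τ, which is an odd derivation along A. The weakened flow equation reads
∂_t A + D = A ∘ X. Its parity components are ∂_t A = A ∘ X₀ and D = A ∘ X₁. Since A ∘ X₁ is an odd
derivation along A for every morphism A, the second equation merely defines D. What remains is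
existence and uniqueness of the flow A of the even field X₀ with initial condition φ.

This flow is treated by induction on the number of odd parameters, each step again splitting off one
odd generator. Without odd parameters A is determined by its body, because pull-backs preserve
bodies (`MorOver.grBody_pull`), and the classical flow provides A. In the inductive step the unknown
is the coefficient D of the new generator. An odd derivation along A is determined by its values on
the coordinates (`IsOddDer.ext`), and these can be prescribed freely with the right parities
(`derOfCoords`). The flow equation becomes a linear differential equation for these values
(`IsEvenFlow.coordODE_top`). Linearity gives a unique solution on all of V, so the nilpotent
directions never shrink the flow domain. Parity of the initial values propagates by uniqueness.
Conversely, the defect ∂_t D − D ∘ X₀ is an odd derivation along A that vanishes on the coordinates,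
hence is zero.

Two tools carry the argument. By `eq_zero_of_leibniz`, an operator with a Leibniz rule that kills
the coordinates is zero: Hadamard's lemma pushes its values into every power of the nilpotent ideal
of elements without body. By `exists_linear_flow`, linear equations are solved smoothly in
parameters: 1 minus a Volterra operator on a space of curves is inverted, and inversion is smooth.
-/

namespace SuperFlow

noncomputable section

/-! ### Smooth families of curves -/

section Curves

open Filter Topology

variable {Z G : Type*} [NormedAddCommGroup Z] [NormedSpace ℝ Z]
  [NormedAddCommGroup G] [NormedSpace ℝ G]

/-- The curve `s ↦ N (s, z)` on the unit interval. -/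
def curve (N : ℝ × Z → G) (z : Z) : C(unitInterval, G) :=
  ContinuousMap.mkD (fun s : unitInterval => N (s, z)) 0

/-- A family of linear maps, regarded as a linear map into a space of curves. -/
def curveFlip : C(unitInterval, Z →L[ℝ] G) →L[ℝ] Z →L[ℝ] C(unitInterval, G) :=
  LinearMap.mkContinuous₂
    (LinearMap.mk₂ ℝ
      (fun (A : C(unitInterval, Z →L[ℝ] G)) (h : Z) =>
        (⟨fun s => A s h, by fun_prop⟩ : C(unitInterval, G)))
      (fun _ _ _ => rfl) (fun _ _ _ => rfl)
      (fun _ _ _ => by ext s; simp) (fun _ _ _ => by ext s; simp)) 1 (fun A h => by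
        rw [one_mul, ContinuousMap.norm_le _ (by positivity)]
        intro s
        exact (A s).le_of_opNorm_le (A.norm_coe_le_norm s) h)

theorem curveFlip_apply (A : C(unitInterval, Z →L[ℝ] G)) (h : Z) (s : unitInterval) :
    curveFlip A h s = A s h := rfl

omit [NormedSpace ℝ Z] [NormedSpace ℝ G] in
theorem curve_apply {N : ℝ × Z → G} {Ω : Set (ℝ × Z)} (hN : ContinuousOn N Ω) {z : Z}
    (hz : ∀ s : unitInterval, ((s : ℝ), z) ∈ Ω) (s : unitInterval) :
    curve N z s = N (s, z) :=
  ContinuousMap.mkD_apply_of_continuous (hN.comp_continuous (by fun_prop) hz)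

omit [NormedSpace ℝ Z] [NormedSpace ℝ G] in
theorem continuousOn_curve {N : ℝ × Z → G} {Ω : Set (ℝ × Z)} (hN : ContinuousOn N Ω) {V : Set Z}
    (hV : ∀ z ∈ V, ∀ s : unitInterval, ((s : ℝ), z) ∈ Ω) : ContinuousOn (curve N) V := by
  refine ContinuousMap.continuousOn_of_continuousOn_uncurry _ ?_
  have h : ContinuousOn (fun x : Z × unitInterval => N (x.2, x.1)) (V ×ˢ univ) :=
    hN.comp (by fun_prop) (fun x hx => hV x.1 hx.1 x.2)
  refine h.congr ?_
  rintro ⟨z, s⟩ hx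
  exact curve_apply hN (hV z hx.1) s

/-- The partial derivative with respect to the parameter. -/
def paramDeriv (N : ℝ × Z → G) (w : ℝ × Z) : Z →L[ℝ] G :=
  (fderiv ℝ N w).comp (ContinuousLinearMap.inr ℝ ℝ Z)

/-- The difference quotient must be controlled uniformly in s. Continuity of the curve of parameter
derivatives in the sup norm gives one ball on which these derivatives vary by less than ε for all s,
and the mean value inequality on that ball does the rest. -/
theorem hasFDerivAt_curve {N : ℝ × Z → G} {Ω : Set (ℝ × Z)} (hΩ : IsOpen Ω)
    (hN : ContDiffOn ℝ 1 N Ω) {V : Set Z} (hVo : IsOpen V)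
    (hV : ∀ z ∈ V, ∀ s : unitInterval, ((s : ℝ), z) ∈ Ω) {z : Z} (hz : z ∈ V) :
    HasFDerivAt (curve N) (curveFlip (curve (paramDeriv N) z)) z := by
  have hP : ContinuousOn (paramDeriv N) Ω := by
    have := hN.continuousOn_fderiv_of_isOpen hΩ le_rfl
    unfold paramDeriv
    fun_prop
  have hc := (continuousOn_curve hP hV).continuousAt (hVo.mem_nhds hz)
  rw [hasFDerivAt_iff_isLittleO_nhds_zero, Asymptotics.isLittleO_iff]
  intro ε hε
  have h1 : ∀ᶠ z' in 𝓝 z, z' ∈ V ∧ dist (curve (paramDeriv N) z') (curve (paramDeriv N) z) < ε :=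
    (hVo.eventually_mem hz).and (Metric.tendsto_nhds.1 hc ε hε)
  obtain ⟨r, hr, hball⟩ := Metric.eventually_nhds_iff_ball.1 h1
  filter_upwards [Metric.ball_mem_nhds (0 : Z) hr] with h hh
  have hzh : z + h ∈ Metric.ball z r := by simpa using hh
  rw [ContinuousMap.norm_le _ (by positivity)]
  intro s
  have hd : ∀ z' ∈ Metric.ball z r, HasFDerivWithinAt (fun z' => N (s, z'))
      (paramDeriv N (s, z')) (Metric.ball z r) z' := by
    intro z' hz'
    have h2 : HasFDerivAt N (fderiv ℝ N (s, z')) ((s : ℝ), z') :=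
      ((hN.contDiffAt (hΩ.mem_nhds (hV z' (hball z' hz').1 s))).differentiableAt
        (by simp)).hasFDerivAt
    exact (h2.comp z' (hasFDerivAt_prodMk_right (s : ℝ) z')).hasFDerivWithinAt
  have hb : ∀ z' ∈ Metric.ball z r, ‖paramDeriv N (s, z') - paramDeriv N (s, z)‖ ≤ ε := by
    intro z' hz'
    have h3 := (ContinuousMap.dist_apply_le_dist (f := curve (paramDeriv N) z')
      (g := curve (paramDeriv N) z) s).trans (hball z' hz').2.le
    rwa [curve_apply hP (hV z' (hball z' hz').1), curve_apply hP (hV z hz), dist_eq_norm] at h3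
  have h4 := (convex_ball z r).norm_image_sub_le_of_norm_hasFDerivWithin_le' hd hb
    (Metric.mem_ball_self hr) hzh
  simp only [add_sub_cancel_left] at h4
  simpa [curve_apply hN.continuousOn (hV _ (hball _ hzh).1), curve_apply hN.continuousOn (hV _ hz),
    curveFlip_apply, curve_apply hP (hV z hz)] using h4

end Curves

/-- The derivative of a family of curves is again, up to the linear map `curveFlip`, a family of
curves, now with values in `Z →L[ℝ] G`. The induction therefore quantifies over G, and all spaces
live in one universe. -/
theorem contDiffOn_curve_nat {Z : Type} [NormedAddCommGroup Z] [NormedSpace ℝ Z]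
    {Ω : Set (ℝ × Z)} (hΩ : IsOpen Ω) {V : Set Z} (hVo : IsOpen V)
    (hV : ∀ z ∈ V, ∀ s : unitInterval, ((s : ℝ), z) ∈ Ω) (k : ℕ) :
    ∀ {G : Type} [NormedAddCommGroup G] [NormedSpace ℝ G] {N : ℝ × Z → G},
      ContDiffOn ℝ ∞ N Ω → ContDiffOn ℝ k (curve N) V := by
  induction k with
  | zero =>
    intro G _ _ N hN
    exact contDiffOn_zero.2 (continuousOn_curve hN.continuousOn hV)
  | succ k ih =>
    intro G _ _ N hN
    have hd := fun z hz => hasFDerivAt_curve hΩ (hN.of_le (by simp)) hVo hV (z := z) hz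
    have hP : ContDiffOn ℝ ∞ (paramDeriv N) Ω := by
      have h1 := hN.fderiv_of_isOpen hΩ (m := ∞) le_rfl
      exact h1.clm_comp contDiffOn_const
    push_cast
    rw [contDiffOn_succ_iff_fderiv_of_isOpen hVo]
    refine ⟨fun z hz => (hd z hz).differentiableAt.differentiableWithinAt, by simp, ?_⟩
    refine (curveFlip.contDiff.comp_contDiffOn (ih hP)).congr ?_
    intro z hz
    exact (hd z hz).fderiv

theorem contDiffOn_curve {Z : Type} [NormedAddCommGroup Z] [NormedSpace ℝ Z]
    {Ω : Set (ℝ × Z)} (hΩ : IsOpen Ω) {V : Set Z} (hVo : IsOpen V)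
    (hV : ∀ z ∈ V, ∀ s : unitInterval, ((s : ℝ), z) ∈ Ω)
    {G : Type} [NormedAddCommGroup G] [NormedSpace ℝ G] {N : ℝ × Z → G}
    (hN : ContDiffOn ℝ ∞ N Ω) : ContDiffOn ℝ ∞ (curve N) V :=
  contDiffOn_infty.2 fun k => contDiffOn_curve_nat hΩ hVo hV k hN

/-! ### Volterra operators -/

section Volterra

variable {K : Type*} [NormedAddCommGroup K] [NormedSpace ℝ K]

/-- The primitive of a curve which vanishes at `0`. -/
def primitive : C(unitInterval, K) →L[ℝ] C(unitInterval, K) :=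
  LinearMap.mkContinuous
    { toFun := fun v => ⟨fun s => ∫ σ in (0 : ℝ)..s, IccExtend zero_le_one v σ, by
        have h : Continuous (IccExtend (zero_le_one' ℝ) v) := v.continuous.Icc_extend'
        exact (intervalIntegral.continuous_primitive (fun a b => h.intervalIntegrable a b) 0).comp
          continuous_subtype_val⟩
      map_add' := fun v w => by
        ext s
        have h : ∀ v : C(unitInterval, K), Continuous (IccExtend (zero_le_one' ℝ) v) :=
          fun v => v.continuous.Icc_extend'
        exact intervalIntegral.integral_add ((h v).intervalIntegrable _ _)
          ((h w).intervalIntegrable _ _)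
      map_smul' := fun c v => by
        ext s
        exact intervalIntegral.integral_smul c (IccExtend (zero_le_one' ℝ) v) } 1 (fun v => by
      rw [one_mul, ContinuousMap.norm_le _ (by positivity)]
      intro s
      have h := intervalIntegral.norm_integral_le_of_norm_le_const (a := (0 : ℝ)) (b := s)
        (C := ‖v‖) (f := IccExtend (zero_le_one' ℝ) v) (fun x _ => v.norm_coe_le_norm _)
      refine h.trans ?_
      rw [sub_zero, abs_of_nonneg s.2.1]
      exact mul_le_of_le_one_right (norm_nonneg _) s.2.2)

/-- The pointwise action of a curve of operators on curves. -/
def curveAct : C(unitInterval, K →L[ℝ] K) →L[ℝ] C(unitInterval, K) →L[ℝ] C(unitInterval, K) :=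
  LinearMap.mkContinuous₂
    (LinearMap.mk₂ ℝ
      (fun (A : C(unitInterval, K →L[ℝ] K)) (v : C(unitInterval, K)) =>
        (⟨fun s => A s (v s), by fun_prop⟩ : C(unitInterval, K)))
      (fun _ _ _ => rfl) (fun _ _ _ => by ext s; simp)
      (fun _ _ _ => by ext s; simp) (fun _ _ _ => by ext s; simp)) 1 (fun A v => by
        rw [one_mul, ContinuousMap.norm_le _ (by positivity)]
        intro s
        exact (A s).le_of_opNorm_le_of_le (A.norm_coe_le_norm s) (v.norm_coe_le_norm s))

/-- The operator `v ↦ (s ↦ ∫₀ˢ A(σ) v(σ) dσ)`. -/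
def volterra : C(unitInterval, K →L[ℝ] K) →L[ℝ] C(unitInterval, K) →L[ℝ] C(unitInterval, K) :=
  (ContinuousLinearMap.compL ℝ _ _ _ primitive).comp curveAct

theorem volterra_apply (A : C(unitInterval, K →L[ℝ] K)) (v : C(unitInterval, K))
    (s : unitInterval) :
    volterra A v s = ∫ σ in (0 : ℝ)..s, IccExtend zero_le_one (curveAct A v) σ := rfl

theorem contDiff_volterra : ContDiff ℝ ∞ (volterra (K := K)) := by fun_prop

theorem contDiffAt_inverse_of_isUnit {F : Type*} [NormedAddCommGroup F] [NormedSpace ℝ F]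
    [CompleteSpace F] {T : F →L[ℝ] F} (hT : IsUnit T) : ContDiffAt ℝ ∞ Ring.inverse T := by
  obtain ⟨T, rfl⟩ := hT
  exact contDiffAt_ringInverse ℝ T

/-- Each further integration of σ ^ k contributes a factor 1 / (k + 1), which builds up the
factorial. The bound has to be pointwise in s for the induction to close. -/
theorem norm_volterra_pow_apply_le (A : C(unitInterval, K →L[ℝ] K)) (v : C(unitInterval, K))
    (k : ℕ) : ∀ s : unitInterval,
      ‖((volterra A) ^ k) v s‖ ≤ (‖A‖ * s) ^ k / (k.factorial : ℝ) * ‖v‖ := by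
  induction k with
  | zero => intro s; simpa using v.norm_coe_le_norm s
  | succ k ih =>
    intro s
    rw [pow_succ', mul_apply_eq_comp, volterra_apply]
    have h1 : ∀ σ ∈ Set.Ioc (0 : ℝ) s,
        ‖IccExtend (zero_le_one' ℝ) (curveAct A ((volterra A ^ k) v)) σ‖ ≤
          ‖A‖ * ((‖A‖ * σ) ^ k / (k.factorial : ℝ) * ‖v‖) := by
      intro σ hσ
      have hσ' : σ ∈ Icc (0 : ℝ) 1 := ⟨hσ.1.le, hσ.2.trans s.2.2⟩
      rw [IccExtend_of_mem _ _ hσ']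
      exact (A ⟨σ, hσ'⟩).le_of_opNorm_le_of_le (A.norm_coe_le_norm _) (ih ⟨σ, hσ'⟩)
    have h2 : Continuous fun σ : ℝ => ‖A‖ * ((‖A‖ * σ) ^ k / (k.factorial : ℝ) * ‖v‖) := by
      fun_prop
    refine (intervalIntegral.norm_integral_le_of_norm_le s.2.1
      (Filter.Eventually.of_forall h1) (h2.intervalIntegrable _ _)).trans (le_of_eq ?_)
    have h3 : ∀ σ : ℝ, ‖A‖ * ((‖A‖ * σ) ^ k / (k.factorial : ℝ) * ‖v‖) =
        (‖A‖ ^ (k + 1) / (k.factorial : ℝ) * ‖v‖) * σ ^ k := by intro σ; ring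
    simp_rw [h3]
    rw [intervalIntegral.integral_const_mul, integral_pow, Nat.factorial_succ]
    push_cast
    field_simp
    ring

/-- The operator T itself need not be small, but some power T ^ k has norm below 1. Then 1 − T ^ k
is invertible, and it factors as 1 − T times a geometric sum commuting with it. -/
theorem isUnit_one_sub_volterra [CompleteSpace K] (A : C(unitInterval, K →L[ℝ] K)) :
    IsUnit (1 - volterra A) := by
  obtain ⟨k, hk⟩ : ∃ k : ℕ, ‖A‖ ^ k / (k.factorial : ℝ) < 1 :=
    ((FloorSemiring.tendsto_pow_div_factorial_atTop ‖A‖).eventually_lt_const one_pos).exists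
  have h1 : ‖volterra A ^ k‖ < 1 := by
    refine lt_of_le_of_lt ?_ hk
    refine ContinuousLinearMap.opNorm_le_bound _ (by positivity) fun v => ?_
    rw [ContinuousMap.norm_le _ (by positivity)]
    intro s
    refine (norm_volterra_pow_apply_le A v k s).trans ?_
    gcongr
    · exact mul_nonneg (norm_nonneg A) s.2.1
    · exact mul_le_of_le_one_right (norm_nonneg A) s.2.2
  have h2 : IsUnit (1 - volterra A ^ k) := (Units.oneSub (volterra A ^ k) h1).isUnit
  rw [← mul_neg_geom_sum] at h2
  have hc : Commute (1 - volterra A) (∑ i ∈ Finset.range k, volterra A ^ i) :=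
    (Commute.sum_right _ _ _ fun i _ =>
      ((Commute.one_left _).sub_left ((Commute.refl (volterra A)).pow_right i)))
  exact (hc.isUnit_mul_iff.1 h2).1

end Volterra

/-! ### Linear differential equations with parameters -/

section LinearODE

variable {E K : Type} [NormedAddCommGroup E] [NormedSpace ℝ E]
  [NormedAddCommGroup K] [NormedSpace ℝ K]

/-- The time-rescaled coefficient of a linear equation: along the segment from `(t₀, x)` to
`(t, x)`. -/
def rescaled (t₀ : ℝ) (M : ℝ × E → K →L[ℝ] K) (w : ℝ × (ℝ × E)) : K →L[ℝ] K :=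
  (w.2.1 - t₀) • M (t₀ + w.1 * (w.2.1 - t₀), w.2.2)

/-- The solution, on the segment from `(t₀, x)` to `(t, x)`, of a linear equation. -/
def segSol (t₀ : ℝ) (M : ℝ × E → K →L[ℝ] K) (u₀ : E → K) (z : ℝ × E) : C(unitInterval, K) :=
  Ring.inverse (1 - volterra (curve (rescaled t₀ M) z)) (ContinuousMap.const _ (u₀ z.2))

/-- Constant curves, as a continuous linear map. -/
def constCurve : K →L[ℝ] C(unitInterval, K) :=
  LinearMap.mkContinuous
    { toFun := fun y => ContinuousMap.const unitInterval y
      map_add' := fun _ _ => rfl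
      map_smul' := fun _ _ => rfl } 1 (fun y => by
        rw [one_mul, ContinuousMap.norm_le _ (by positivity)]
        exact fun _ => le_rfl)

omit [NormedAddCommGroup E] [NormedSpace ℝ E] in
theorem segSol_eq [CompleteSpace K] (t₀ : ℝ) (M : ℝ × E → K →L[ℝ] K) (u₀ : E → K) (z : ℝ × E) :
    segSol t₀ M u₀ z = ContinuousMap.const _ (u₀ z.2) +
      volterra (curve (rescaled t₀ M) z) (segSol t₀ M u₀ z) := by
  have h := congrArg (fun L : C(unitInterval, K) →L[ℝ] C(unitInterval, K) =>
    L (ContinuousMap.const _ (u₀ z.2)))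
      (Ring.mul_inverse_cancel _ (isUnit_one_sub_volterra (curve (rescaled t₀ M) z)))
  exact sub_eq_iff_eq_add.1 h

-- Invertibility of 1 minus the Volterra operator makes the integral equation characterize its
-- solution, so that curves can be identified by checking the equation.
omit [NormedAddCommGroup E] [NormedSpace ℝ E] in
theorem eq_segSol [CompleteSpace K] {t₀ : ℝ} {M : ℝ × E → K →L[ℝ] K} {u₀ : E → K} {z : ℝ × E}
    {v : C(unitInterval, K)}
    (hv : v = ContinuousMap.const _ (u₀ z.2) + volterra (curve (rescaled t₀ M) z) v) :
    v = segSol t₀ M u₀ z := by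
  have h1 : (1 - volterra (curve (rescaled t₀ M) z)) v = ContinuousMap.const _ (u₀ z.2) :=
    sub_eq_iff_eq_add.2 hv
  have h := congrArg (fun L : C(unitInterval, K) →L[ℝ] C(unitInterval, K) => L v)
      (Ring.inverse_mul_cancel _ (isUnit_one_sub_volterra (curve (rescaled t₀ M) z)))
  rw [segSol, ← h1]
  exact h.symm

variable {V : Set (ℝ × E)} {t₀ : ℝ} {M : ℝ × E → K →L[ℝ] K} {u₀ : E → K}

omit [NormedSpace ℝ E] in
theorem isOpen_rescaled_domain (hV : IsOpen V) :
    IsOpen {w : ℝ × (ℝ × E) | (t₀ + w.1 * (w.2.1 - t₀), w.2.2) ∈ V} :=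
  hV.preimage (by fun_prop)

theorem contDiffOn_rescaled (hM : ContDiffOn ℝ ∞ M V) :
    ContDiffOn ℝ ∞ (rescaled t₀ M) {w | (t₀ + w.1 * (w.2.1 - t₀), w.2.2) ∈ V} := by
  have h1 : ContDiff ℝ ∞ fun w : ℝ × (ℝ × E) => (t₀ + w.1 * (w.2.1 - t₀), w.2.2) := by fun_prop
  have h2 : ContDiff ℝ ∞ fun w : ℝ × (ℝ × E) => w.2.1 - t₀ := by fun_prop
  exact h2.contDiffOn.smul (hM.comp h1.contDiffOn fun w hw => hw)

theorem curve_rescaled_apply (hM : ContDiffOn ℝ ∞ M V)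
    (hseg : ∀ z ∈ V, ∀ s ∈ unitInterval, (t₀ + s * (z.1 - t₀), z.2) ∈ V) {z : ℝ × E} (hz : z ∈ V)
    (s : unitInterval) :
    curve (rescaled t₀ M) z s = (z.1 - t₀) • M (t₀ + s * (z.1 - t₀), z.2) :=
  curve_apply (contDiffOn_rescaled hM).continuousOn (fun s => hseg z hz s s.2) s

/-- The solution is a composite of smooth maps: the coefficient curve, the linear map `volterra`,
inversion at a unit, and evaluation of operators on a constant curve. -/
theorem contDiffOn_segSol [CompleteSpace K] (hV : IsOpen V) (hM : ContDiffOn ℝ ∞ M V)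
    (hseg : ∀ z ∈ V, ∀ s ∈ unitInterval, (t₀ + s * (z.1 - t₀), z.2) ∈ V)
    (hu₀ : ContDiffOn ℝ ∞ (fun z : ℝ × E => u₀ z.2) V) :
    ContDiffOn ℝ ∞ (segSol t₀ M u₀) V := by
  have hΩ := isOpen_rescaled_domain (t₀ := t₀) hV
  have hN := contDiffOn_rescaled (t₀ := t₀) hM
  have h1 : ContDiffOn ℝ ∞ (curve (rescaled t₀ M)) V :=
    contDiffOn_curve (Z := ℝ × E) (G := K →L[ℝ] K) hΩ hV (fun z hz s => hseg z hz s s.2) hN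
  have h2 : ContDiffOn ℝ ∞ (fun z => 1 - volterra (curve (rescaled t₀ M) z)) V :=
    contDiffOn_const.sub (contDiff_volterra.comp_contDiffOn h1)
  have h3 : ContDiffOn ℝ ∞
      (fun z => Ring.inverse (1 - volterra (curve (rescaled t₀ M) z))) V := by
    intro z hz
    have h4 := contDiffAt_inverse_of_isUnit
      (isUnit_one_sub_volterra (curve (rescaled t₀ M) z))
    exact h4.comp_contDiffWithinAt z (h2 z hz)
  have h5 : ContDiffOn ℝ ∞ (fun z : ℝ × E => ContinuousMap.const unitInterval (u₀ z.2)) V :=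
    ContDiff.comp_contDiffOn (g := fun y : K => ContinuousMap.const unitInterval y)
      (constCurve (K := K)).contDiff hu₀
  exact h3.clm_apply h5

/-- The initial part of the solution towards z, rescaled to the unit interval, satisfies the
integral equation of the segment ending at the intermediate point. Hence the endpoint values alone
form a function that contains all the solution curves. -/
theorem segSol_apply_eq [CompleteSpace K] (hM : ContDiffOn ℝ ∞ M V)
    (hseg : ∀ z ∈ V, ∀ s ∈ unitInterval, (t₀ + s * (z.1 - t₀), z.2) ∈ V) {z : ℝ × E} (hz : z ∈ V)
    (s : unitInterval) :
    segSol t₀ M u₀ z s = segSol t₀ M u₀ (t₀ + s * (z.1 - t₀), z.2) 1 := by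
  set z' : ℝ × E := (t₀ + s * (z.1 - t₀), z.2) with hz'
  have hzV : z' ∈ V := hseg z hz s s.2
  set v : C(unitInterval, K) := ⟨fun σ => segSol t₀ M u₀ z (s * σ), by fun_prop⟩ with hv
  have h1 : v = segSol t₀ M u₀ z' := by
    refine eq_segSol (ContinuousMap.ext fun σ => ?_)
    have h2 : v σ = segSol t₀ M u₀ z (s * σ) := rfl
    rw [h2, segSol_eq]
    change u₀ z.2 + volterra _ _ _ = u₀ z'.2 + volterra _ _ _
    congr 1
    rw [volterra_apply, volterra_apply]
    have h3 := intervalIntegral.smul_integral_comp_mul_left (a := 0) (b := σ)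
      (IccExtend (zero_le_one' ℝ) (curveAct (curve (rescaled t₀ M) z) (segSol t₀ M u₀ z))) (s : ℝ)
    rw [mul_zero] at h3
    rw [show ((s * σ : unitInterval) : ℝ) = (s : ℝ) * σ from rfl, ← h3,
      ← intervalIntegral.integral_smul]
    refine intervalIntegral.integral_congr fun r hr => ?_
    rw [uIcc_of_le σ.2.1] at hr
    have hr1 : r ∈ unitInterval := ⟨hr.1, hr.2.trans σ.2.2⟩
    have hr2 : (s : ℝ) * r ∈ unitInterval := unitInterval.mul_mem s.2 hr1
    rw [IccExtend_of_mem _ _ hr1, IccExtend_of_mem _ _ hr2]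
    change (s : ℝ) • (curve (rescaled t₀ M) z ⟨s * r, hr2⟩) (segSol t₀ M u₀ z ⟨s * r, hr2⟩) =
      (curve (rescaled t₀ M) z' ⟨r, hr1⟩) (segSol t₀ M u₀ z ⟨s * r, hr2⟩)
    rw [curve_rescaled_apply hM hseg hz, curve_rescaled_apply hM hseg hzV]
    have h6 : t₀ + r * (z'.1 - t₀) = t₀ + s * r * (z.1 - t₀) := by simp only [hz']; ring
    have h7 : z'.1 - t₀ = s * (z.1 - t₀) := by simp only [hz']; ring
    rw [h6, h7, mul_smul]
    rfl
  have h8 := congrArg (fun v : C(unitInterval, K) => v 1) h1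
  simpa [hv] using h8

/-- **Smooth dependence on parameters** for homogeneous linear differential equations, with
existence on the whole domain of the coefficients. -/
theorem exists_linear_flow [CompleteSpace K] (hV : IsOpen V) (hM : ContDiffOn ℝ ∞ M V)
    (hseg : ∀ z ∈ V, ∀ s ∈ unitInterval, (t₀ + s * (z.1 - t₀), z.2) ∈ V)
    (hu₀ : ContDiffOn ℝ ∞ (fun z : ℝ × E => u₀ z.2) V) :
    ∃ u : ℝ × E → K, ContDiffOn ℝ ∞ u V ∧ (∀ x, (t₀, x) ∈ V → u (t₀, x) = u₀ x) ∧
      ∀ t x, (t, x) ∈ V → HasDerivAt (fun s => u (s, x)) (M (t, x) (u (t, x))) t := by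
  set u : ℝ × E → K := fun z => segSol t₀ M u₀ z 1 with hu
  have husm : ContDiffOn ℝ ∞ u V :=
    (ContinuousMap.evalCLM ℝ (1 : unitInterval) : C(unitInterval, K) →L[ℝ] K).contDiff.comp_contDiffOn
      (contDiffOn_segSol hV hM hseg hu₀)
  -- The substitution τ = t₀ + r (t − t₀) turns the Volterra equation at the endpoint 1 into the
  -- usual integral equation, with `segSol_apply_eq` identifying the integrand.
  have hint : ∀ t x, (t, x) ∈ V →
      u (t, x) = u₀ x + ∫ τ in t₀..t, M (τ, x) (u (τ, x)) := by
    intro t x htx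
    change segSol t₀ M u₀ (t, x) 1 = _
    rw [segSol_eq]
    change u₀ x + volterra _ _ _ = _
    congr 1
    rw [volterra_apply]
    have h3 := intervalIntegral.smul_integral_comp_add_mul (a := 0) (b := 1)
      (fun τ => M (τ, x) (u (τ, x))) (t - t₀) t₀
    rw [mul_zero, mul_one, add_zero, add_sub_cancel] at h3
    rw [← h3, ← intervalIntegral.integral_smul]
    refine intervalIntegral.integral_congr fun r hr => ?_
    have hr1 : r ∈ unitInterval := by
      rwa [show ((1 : unitInterval) : ℝ) = 1 from rfl, uIcc_of_le zero_le_one] at hr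
    rw [IccExtend_of_mem _ _ hr1]
    change (curve (rescaled t₀ M) (t, x) ⟨r, hr1⟩) (segSol t₀ M u₀ (t, x) ⟨r, hr1⟩) = _
    rw [curve_rescaled_apply hM hseg htx, segSol_apply_eq hM hseg htx]
    simp only [hu, mul_comm r, smul_apply]
  refine ⟨u, husm, fun x hx => by simp [hint t₀ x hx], fun t x htx => ?_⟩
  have hO : IsOpen {τ : ℝ | (τ, x) ∈ V} := hV.preimage (by fun_prop)
  have hc : ContinuousOn (fun τ => M (τ, x) (u (τ, x))) {τ : ℝ | (τ, x) ∈ V} := by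
    have h1 : ContinuousOn (fun z => M z (u z)) V := hM.continuousOn.clm_apply husm.continuousOn
    exact h1.comp (f := fun τ : ℝ => (τ, x)) (by fun_prop) (fun τ hτ => hτ)
  have hsub : uIcc t₀ t ⊆ {τ : ℝ | (τ, x) ∈ V} := by
    intro τ hτ
    rw [← segment_eq_uIcc, segment_eq_image'] at hτ
    obtain ⟨s, hs, rfl⟩ := hτ
    exact hseg (t, x) htx s hs
  have h1 := intervalIntegral.integral_hasDerivAt_right
    ((hc.mono hsub).intervalIntegrable (μ := MeasureTheory.volume))
    (hc.stronglyMeasurableAtFilter hO t htx) (hc.continuousAt (hO.mem_nhds htx))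
  refine (h1.const_add (u₀ x)).congr_of_eventuallyEq ?_
  filter_upwards [hO.mem_nhds htx] with τ hτ
  exact hint τ x hτ

end LinearODE

/-! ### Uniqueness for differential equations -/

section Uniqueness

open Filter Topology

variable {K : Type*} [NormedAddCommGroup K] [NormedSpace ℝ K]

/-- Uniqueness on an interval of the solutions of a differential equation whose right-hand side
is locally Lipschitz along one of the solutions. -/
theorem ode_unique_of_locally_lipschitz {I : Set ℝ} (hI : IsOpen I) (hc : OrdConnected I)
    {v : ℝ → K → K} {f g : ℝ → K} {t₀ : ℝ} (ht₀ : t₀ ∈ I)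
    (hv : ∀ t ∈ I, ∃ C, ∃ S ∈ 𝓝 (f t), ∀ᶠ τ in 𝓝 t, LipschitzOnWith C (v τ) S)
    (hf : ∀ t ∈ I, HasDerivAt f (v t (f t)) t) (hg : ∀ t ∈ I, HasDerivAt g (v t (g t)) t)
    (h0 : f t₀ = g t₀) : EqOn f g I := by
  have hlocal : ∀ t ∈ I, f t = g t → f =ᶠ[𝓝 t] g := by
    intro t ht h
    obtain ⟨C, S, hS, hL⟩ := hv t ht
    refine ODE_solution_unique_of_eventually (s := fun _ => S) (v := v) (K := C) hL ?_ ?_ h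
    · filter_upwards [hI.mem_nhds ht, (hf t ht).continuousAt hS] with τ h1 h2
      exact ⟨hf τ h1, h2⟩
    · filter_upwards [hI.mem_nhds ht, (hg t ht).continuousAt (h ▸ hS)] with τ h1 h2
      exact ⟨hg τ h1, h2⟩
  have hfc : ContinuousOn f I := fun t ht => (hf t ht).continuousAt.continuousWithinAt
  have hgc : ContinuousOn g I := fun t ht => (hg t ht).continuousAt.continuousWithinAt
  have hpre : IsPreconnected I := hc.isPreconnected
  -- The interior of the coincidence set contains t₀ and is closed relative to I: at a limit point
  -- in I the solutions agree by continuity, hence nearby by local uniqueness. Connectedness of I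
  -- concludes.
  have hsub : I ⊆ interior {t | f t = g t} := by
    refine hpre.subset_of_closure_inter_subset isOpen_interior ?_ ?_
    · exact ⟨t₀, ht₀, mem_interior_iff_mem_nhds.2 (hlocal t₀ ht₀ h0)⟩
    · rintro t ⟨htc, ht⟩
      rw [mem_interior_iff_mem_nhds]
      refine hlocal t ht ?_
      have h1 : ∃ᶠ τ in 𝓝 t, f τ = g τ :=
        (mem_closure_iff_frequently.1 htc).mono fun τ hτ =>
          (interior_subset (s := {t | f t = g t}) hτ :)
      have h2 := (hf t ht).continuousAt
      have h3 := (hg t ht).continuousAt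
      exact tendsto_nhds_unique_of_frequently_eq h2 h3 h1
  exact fun t ht => (interior_subset (hsub ht) :)

/-- Uniqueness for linear equations. -/
theorem linear_ode_unique {I : Set ℝ} (hI : IsOpen I) (hc : OrdConnected I)
    {M : ℝ → K →L[ℝ] K} (hM : ContinuousOn M I) {f g : ℝ → K} {t₀ : ℝ} (ht₀ : t₀ ∈ I)
    (hf : ∀ t ∈ I, HasDerivAt f (M t (f t)) t) (hg : ∀ t ∈ I, HasDerivAt g (M t (g t)) t)
    (h0 : f t₀ = g t₀) : EqOn f g I := by
  refine ode_unique_of_locally_lipschitz hI hc (v := fun t => M t) ht₀ ?_ hf hg h0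
  intro t ht
  -- By continuity of M, the bound ‖M t‖ + 1 serves as a global Lipschitz constant for all nearby
  -- times.
  refine ⟨‖M t‖₊ + 1, univ, univ_mem, ?_⟩
  have h1 := (hM.continuousAt (hI.mem_nhds ht)).nnnorm.eventually_lt_const
    (lt_add_one ‖M t‖₊)
  filter_upwards [h1] with τ hτ
  exact ((M τ).lipschitz.weaken hτ.le).lipschitzOnWith

/-- Uniqueness for autonomous equations. -/
theorem autonomous_ode_unique {I : Set ℝ} (hI : IsOpen I) (hc : OrdConnected I)
    {Y : K → K} {W : Set K} (hW : IsOpen W) (hY : ContDiffOn ℝ 1 Y W)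
    {f g : ℝ → K} {t₀ : ℝ} (ht₀ : t₀ ∈ I) (hfW : ∀ t ∈ I, f t ∈ W)
    (hf : ∀ t ∈ I, HasDerivAt f (Y (f t)) t) (hg : ∀ t ∈ I, HasDerivAt g (Y (g t)) t)
    (h0 : f t₀ = g t₀) : EqOn f g I := by
  refine ode_unique_of_locally_lipschitz hI hc (v := fun _ => Y) ht₀ ?_ hf hg h0
  intro t ht
  obtain ⟨C, S, hS, hL⟩ :=
    (hY.contDiffAt (hW.mem_nhds (hfW t ht))).exists_lipschitzOnWith
  exact ⟨C, S, hS, Eventually.of_forall fun _ => hL⟩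

end Uniqueness

/-- **Hadamard's lemma** on a ball. -/
theorem exists_hadamard {p : ℕ} {F : Type} [NormedAddCommGroup F] [NormedSpace ℝ F]
    [CompleteSpace F] {f : (Fin p → ℝ) → F} {c : Fin p → ℝ} {r : ℝ}
    (hf : ContDiffOn ℝ ∞ f (Metric.ball c r)) :
    ∃ g : Fin p → (Fin p → ℝ) → F, (∀ i, ContDiffOn ℝ ∞ (g i) (Metric.ball c r)) ∧
      ∀ y ∈ Metric.ball c r, f y = f c + ∑ i, (y i - c i) • g i y := by
  set B := Metric.ball c r
  set Ω : Set (ℝ × (Fin p → ℝ)) := {w | c + w.1 • (w.2 - c) ∈ B}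
  have hm : ContDiff ℝ ∞ fun w : ℝ × (Fin p → ℝ) => c + w.1 • (w.2 - c) := by fun_prop
  have hΩo : IsOpen Ω := Metric.isOpen_ball.preimage hm.continuous
  have hseg : ∀ y ∈ B, ∀ s : unitInterval, ((s : ℝ), y) ∈ Ω := by
    intro y hy s
    have hr : 0 < r := dist_nonneg.trans_lt hy
    exact (convex_ball c r).add_smul_sub_mem (Metric.mem_ball_self hr) hy s.2
  set N : Fin p → ℝ × (Fin p → ℝ) → F :=
    fun i w => fderiv ℝ f (c + w.1 • (w.2 - c)) (Pi.single i 1) with hN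
  have hNs : ∀ i, ContDiffOn ℝ ∞ (N i) Ω := fun i =>
    ((hf.fderiv_of_isOpen Metric.isOpen_ball (m := ∞) le_rfl).comp hm.contDiffOn
      fun w hw => hw).clm_apply contDiffOn_const
  -- The factors are the integrals over s in [0, 1] of the partial derivatives ∂ᵢf(c + s (y − c)).
  -- They are smooth because the curves under the integral depend smoothly on y.
  refine ⟨fun i y => primitive (curve (N i) y) 1, fun i => ?_, fun y hy => ?_⟩
  · have h1 := contDiffOn_curve hΩo Metric.isOpen_ball hseg (hNs i)
    have h2 : ContDiff ℝ ∞ fun v : C(unitInterval, F) => primitive v 1 :=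
      ((ContinuousMap.evalCLM ℝ (1 : unitInterval) : C(unitInterval, F) →L[ℝ] F).comp
        primitive).contDiff
    exact h2.comp_contDiffOn h1
  · have hc : ∀ i, Continuous (IccExtend (zero_le_one' ℝ) (curve (N i) y)) :=
      fun i => (curve (N i) y).continuous.Icc_extend'
    have h1 : (∑ i, (y i - c i) • primitive (curve (N i) y) 1) =
        ∫ s in (0 : ℝ)..1, ∑ i, (y i - c i) • IccExtend (zero_le_one' ℝ) (curve (N i) y) s := by
      rw [intervalIntegral.integral_finsetSum]
      · refine Finset.sum_congr rfl fun i _ => ?_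
        rw [intervalIntegral.integral_smul]
        rfl
      · exact fun i _ => ((hc i).const_smul _).intervalIntegrable _ _
    have h2 : (∫ s in (0 : ℝ)..1,
        ∑ i, (y i - c i) • IccExtend (zero_le_one' ℝ) (curve (N i) y) s) =
          f (c + (1 : ℝ) • (y - c)) - f (c + (0 : ℝ) • (y - c)) := by
      refine intervalIntegral.integral_eq_sub_of_hasDerivAt (f := fun s => f (c + s • (y - c)))
        ?_ ?_
      · intro s hs
        rw [uIcc_of_le zero_le_one] at hs
        have h3 : c + s • (y - c) ∈ B := hseg y hy ⟨s, hs⟩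
        have h4 : HasFDerivAt f (fderiv ℝ f (c + s • (y - c))) (c + s • (y - c)) :=
          ((hf.contDiffAt (Metric.isOpen_ball.mem_nhds h3)).differentiableAt
            (by simp)).hasFDerivAt
        have h5 : HasDerivAt (fun s : ℝ => c + s • (y - c)) (y - c) s := by
          simpa using ((hasDerivAt_id s).smul_const (y - c)).const_add c
        have h6 := h4.comp_hasDerivAt s h5
        refine h6.congr_deriv ?_
        have h7 : y - c = ∑ i, (y i - c i) • (Pi.single i (1 : ℝ) : Fin p → ℝ) := by
          ext j
          simp [Finset.sum_apply, Pi.single_apply]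
        conv_lhs => rw [h7, map_sum]
        refine Finset.sum_congr rfl fun i _ => ?_
        rw [IccExtend_of_mem _ _ hs, curve_apply (hNs i).continuousOn (hseg y hy), map_smul,
          ← h7]
      · refine Continuous.intervalIntegrable ?_ _ _
        exact continuous_finsetSum _ fun i _ => (hc i).const_smul _
    rw [h1, h2]
    simp

/-! ### The Grassmann algebra -/

section Grassmann

variable {n : ℕ}

/-- The grade involution of the Grassmann algebra. -/
def grInv (n : ℕ) : Gr n →ₐ[ℝ] Gr n :=
  CliffordAlgebra.involute (Q := (0 : QuadraticForm ℝ (Fin n → ℝ)))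

/-- The embedding of a vector as an odd element. -/
def grι (n : ℕ) : (Fin n → ℝ) →ₗ[ℝ] Gr n := ExteriorAlgebra.ι ℝ

/-- The odd generator number `r`. -/
def gen {n : ℕ} (r : Fin n) : Gr n := grι n (Pi.single r 1)

/-- The left contraction with a linear form on the space of odd generators. -/
def contr (d : Module.Dual ℝ (Fin n → ℝ)) : Gr n →ₗ[ℝ] Gr n :=
  CliffordAlgebra.contractLeft (Q := (0 : QuadraticForm ℝ (Fin n → ℝ))) d

theorem gr_left_induction {P : Gr n → Prop} (hs : ∀ r : ℝ, P (algebraMap ℝ _ r))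
    (ha : ∀ x y, P x → P y → P (x + y)) (hm : ∀ v x, P x → P (grι n v * x)) (z : Gr n) : P z :=
  CliffordAlgebra.left_induction (Q := (0 : QuadraticForm ℝ (Fin n → ℝ))) hs ha
    (fun x v hx => hm v x hx) z

@[simp] theorem grInv_ι (v : Fin n → ℝ) : grInv n (grι n v) = -grι n v :=
  CliffordAlgebra.involute_ι v

@[simp] theorem grInv_grInv (z : Gr n) : grInv n (grInv n z) = z :=
  CliffordAlgebra.involute_involute z

@[simp] theorem contr_algebraMap (d : Module.Dual ℝ (Fin n → ℝ)) (r : ℝ) :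
    contr d (algebraMap ℝ (Gr n) r) = 0 :=
  CliffordAlgebra.contractLeft_algebraMap _ _ _

theorem contr_ι_mul (d : Module.Dual ℝ (Fin n → ℝ)) (v : Fin n → ℝ) (z : Gr n) :
    contr d (grι n v * z) = d v • z - grι n v * contr d z :=
  CliffordAlgebra.contractLeft_ι_mul _ _ _

theorem contr_mul (d : Module.Dual ℝ (Fin n → ℝ)) (z w : Gr n) :
    contr d (z * w) = contr d z * w + grInv n z * contr d w := by
  induction z using gr_left_induction with
  | hs r =>
    rw [contr_algebraMap, AlgHom.commutes, zero_mul, zero_add, ← Algebra.smul_def, map_smul,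
      Algebra.smul_def]
  | ha x y hx hy => rw [add_mul, map_add, hx, hy, map_add, map_add]; noncomm_ring
  | hm v x hx =>
    rw [mul_assoc, contr_ι_mul, hx, contr_ι_mul, map_mul, grInv_ι, sub_mul, smul_mul_assoc]
    noncomm_ring

theorem contr_grInv (d : Module.Dual ℝ (Fin n → ℝ)) (z : Gr n) :
    contr d (grInv n z) = -grInv n (contr d z) := by
  induction z using gr_left_induction with
  | hs r => simp
  | ha x y hx hy => simp only [map_add, hx, hy]; abel
  | hm v x hx =>
    rw [map_mul, grInv_ι, neg_mul, map_neg, contr_ι_mul, hx, contr_ι_mul, map_sub, map_mul,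
      grInv_ι, map_smul]
    noncomm_ring

theorem gr_eq_zero_of_eq_neg {z : Gr n} (h : z = -z) : z = 0 := by
  have h1 : (2 : ℝ) • z = 0 := by rw [two_smul, ← eq_neg_iff_add_eq_zero]; exact h
  exact (smul_eq_zero.1 h1).resolve_left two_ne_zero

/-- Parity becomes an eigenvalue equation for the grade involution, which can be handled by
algebraic identities without choosing homogeneous components. -/
theorem mem_grPart_zero_iff {z : Gr n} : z ∈ grPart n 0 ↔ grInv n z = z := by
  refine ⟨fun h => CliffordAlgebra.involute_eq_of_mem_even h, fun h => ?_⟩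
  obtain ⟨a, ha, b, hb, rfl⟩ := Submodule.mem_sup.1 (show z ∈ _ from
    (CliffordAlgebra.evenOdd_isCompl (Q := (0 : QuadraticForm ℝ (Fin n → ℝ)))).sup_eq_top ▸
      Submodule.mem_top)
  have h1 : grInv n a = a := CliffordAlgebra.involute_eq_of_mem_even ha
  have h2 : grInv n b = -b := CliffordAlgebra.involute_eq_of_mem_odd hb
  rw [map_add, h1, h2] at h
  have h3 : b = 0 := gr_eq_zero_of_eq_neg (add_left_cancel h).symm
  rw [h3, add_zero]
  exact ha

theorem mem_grPart_one_iff {z : Gr n} : z ∈ grPart n 1 ↔ grInv n z = -z := by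
  refine ⟨fun h => CliffordAlgebra.involute_eq_of_mem_odd h, fun h => ?_⟩
  obtain ⟨a, ha, b, hb, rfl⟩ := Submodule.mem_sup.1 (show z ∈ _ from
    (CliffordAlgebra.evenOdd_isCompl (Q := (0 : QuadraticForm ℝ (Fin n → ℝ)))).sup_eq_top ▸
      Submodule.mem_top)
  have h1 : grInv n a = a := CliffordAlgebra.involute_eq_of_mem_even ha
  have h2 : grInv n b = -b := CliffordAlgebra.involute_eq_of_mem_odd hb
  rw [map_add, h1, h2, neg_add] at h
  have h3 : a = 0 := gr_eq_zero_of_eq_neg (add_right_cancel h)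
  rw [h3, zero_add]
  exact hb

theorem ι_mul_ι (v w : Fin n → ℝ) : grι n v * grι n w = -(grι n w * grι n v) :=
  eq_neg_of_add_eq_zero_left (ExteriorAlgebra.ι_add_mul_swap v w)

theorem ι_mul (v : Fin n → ℝ) (z : Gr n) : grι n v * z = grInv n z * grι n v := by
  induction z using gr_left_induction with
  | hs r => rw [AlgHom.commutes, Algebra.commutes]
  | ha x y hx hy => rw [mul_add, hx, hy, map_add, add_mul]
  | hm w x hx => rw [← mul_assoc, ι_mul_ι, neg_mul, mul_assoc, hx, map_mul, grInv_ι]; noncomm_ring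

/-- Even elements are central. -/
theorem mul_comm_of_even {b : Gr n} (hb : grInv n b = b) (z : Gr n) : b * z = z * b := by
  induction z using gr_left_induction with
  | hs r => rw [Algebra.commutes]
  | ha x y hx hy => rw [mul_add, hx, hy, add_mul]
  | hm w x hx => rw [mul_assoc, ← hx, ← mul_assoc, ← mul_assoc, ι_mul, hb]

/-- Odd elements commute with the other elements up to the grade involution. -/
theorem mul_comm_of_odd {b : Gr n} (hb : grInv n b = -b) (z : Gr n) :
    b * z = grInv n z * b := by
  induction z using gr_left_induction with
  | hs r => rw [AlgHom.commutes, Algebra.commutes]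
  | ha x y hx hy => rw [mul_add, hx, hy, map_add, add_mul]
  | hm w x hx =>
    rw [map_mul, mul_assoc, ← hx, grInv_ι, neg_mul, ← mul_assoc, ← mul_assoc, ι_mul, hb]
    noncomm_ring

@[simp] theorem grBody_ι (v : Fin n → ℝ) : grBody n (grι n v) = 0 :=
  by simp [grBody, grι, ExteriorAlgebra.algebraMapInv]

@[simp] theorem grBody_grInv (z : Gr n) : grBody n (grInv n z) = grBody n z := by
  induction z using gr_left_induction with
  | hs r => simp
  | ha x y hx hy => simp only [map_add, hx, hy]
  | hm w x hx => simp

theorem grBody_eq_zero_of_odd {z : Gr n} (hz : grInv n z = -z) : grBody n z = 0 := by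
  have h := grBody_grInv z
  rw [hz, map_neg] at h
  linarith

theorem eq_algebraMap_grBody (z : Gr 0) : z = algebraMap ℝ (Gr 0) (grBody 0 z) := by
  induction z using gr_left_induction with
  | hs r => simp
  | ha x y hx hy => rw [map_add, map_add, ← hx, ← hy]
  | hm w x hx => rw [Subsingleton.elim w 0, map_zero, zero_mul, map_zero, map_zero]

/-! Splitting off the first odd generator. -/

/-- The linear inclusion of the space of odd generators which skips the generator number `0`. -/
def skipTau (n : ℕ) : (Fin n → ℝ) →ₗ[ℝ] (Fin (n + 1) → ℝ) :=
  LinearMap.pi (Fin.cases 0 fun i => LinearMap.proj i)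

/-- The inclusion `Λ ℝⁿ → Λ ℝⁿ⁺¹` which skips the generator number `0`. -/
def emb (n : ℕ) : Gr n →ₐ[ℝ] Gr (n + 1) := ExteriorAlgebra.map (skipTau n)

/-- The quotient map `Λ ℝⁿ⁺¹ → Λ ℝⁿ` which kills the generator number `0`. -/
def kill (n : ℕ) : Gr (n + 1) →ₐ[ℝ] Gr n := ExteriorAlgebra.map (killTau n)

/-- The coefficient of the generator number `0`. -/
def top (n : ℕ) : Gr (n + 1) →ₗ[ℝ] Gr n :=
  (kill n).toLinearMap ∘ₗ contr (LinearMap.proj (0 : Fin (n + 1)))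

theorem top_apply (z : Gr (n + 1)) :
    top n z = kill n (contr (LinearMap.proj (0 : Fin (n + 1))) z) := rfl

theorem killTau_skipTau (v : Fin n → ℝ) : killTau n (skipTau n v) = v := rfl

theorem skipTau_killTau (v : Fin (n + 1) → ℝ) :
    v = v 0 • Pi.single 0 1 + skipTau n (killTau n v) := by
  ext i
  refine Fin.cases ?_ (fun j => ?_) i
  · simp [skipTau]
  · simp [skipTau, killTau, LinearMap.funLeft]

@[simp] theorem emb_ι (v : Fin n → ℝ) : emb n (grι n v) = grι (n + 1) (skipTau n v) :=
  ExteriorAlgebra.map_apply_ι _ _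

@[simp] theorem kill_ι (v : Fin (n + 1) → ℝ) : kill n (grι (n + 1) v) = grι n (killTau n v) :=
  ExteriorAlgebra.map_apply_ι _ _

@[simp] theorem kill_gen_zero : kill n (gen 0) = 0 := by
  have h : killTau n (Pi.single 0 1) = 0 := by ext i; simp [killTau, LinearMap.funLeft]
  rw [gen, kill_ι, h, map_zero]

theorem ι_eq_gen_add_emb (v : Fin (n + 1) → ℝ) :
    grι (n + 1) v = v 0 • gen 0 + emb n (grι n (killTau n v)) := by
  conv_lhs => rw [skipTau_killTau v]
  rw [map_add, map_smul, emb_ι, gen]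

@[simp] theorem kill_emb (z : Gr n) : kill n (emb n z) = z := by
  induction z using gr_left_induction with
  | hs r => simp
  | ha x y hx hy => simp only [map_add, hx, hy]
  | hm w x hx => simp [hx, killTau_skipTau]

theorem grInv_emb (z : Gr n) : grInv (n + 1) (emb n z) = emb n (grInv n z) := by
  induction z using gr_left_induction with
  | hs r => simp
  | ha x y hx hy => simp only [map_add, hx, hy]
  | hm w x hx => simp [hx]

theorem grInv_kill (z : Gr (n + 1)) : grInv n (kill n z) = kill n (grInv (n + 1) z) := by
  induction z using gr_left_induction with
  | hs r => simp
  | ha x y hx hy => simp only [map_add, hx, hy]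
  | hm w x hx => simp [hx]

@[simp] theorem grInv_gen (r : Fin n) : grInv n (gen r) = -gen r := grInv_ι _

theorem gen_mul (r : Fin n) (z : Gr n) : gen r * z = grInv n z * gen r := ι_mul _ z

@[simp] theorem gen_mul_self (r : Fin n) : gen r * gen r = 0 := ExteriorAlgebra.ι_sq_zero _

theorem top_emb (z : Gr n) : top n (emb n z) = 0 := by
  rw [top_apply]
  induction z using gr_left_induction with
  | hs r => simp
  | ha x y hx hy => simp only [map_add, hx, hy, add_zero]
  | hm w x hx =>
    rw [map_mul, emb_ι, contr_ι_mul, map_sub, map_mul, hx, mul_zero, sub_zero, map_smul]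
    simp [skipTau]

theorem top_gen_mul (z : Gr (n + 1)) : top n (gen 0 * z) = kill n z := by
  rw [top_apply, gen, contr_ι_mul, map_sub, map_mul, ← gen, kill_gen_zero]
  simp

/-- This is the splitting of the algebra into Λ ℝⁿ and τ Λ ℝⁿ, with τ the generator number 0. Under
left multiplication by a vector, the component along τ feeds the coefficient of τ, and the remaining
part anticommutes past τ. -/
theorem eq_emb_add_gen_mul (z : Gr (n + 1)) :
    z = emb n (kill n z) + gen 0 * emb n (top n z) := by
  induction z using gr_left_induction with
  | hs r => simp [top_apply]
  | ha x y hx hy =>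
    conv_lhs => rw [hx, hy]
    simp only [map_add]
    noncomm_ring
  | hm v x hx =>
    have h1 : top n (grι (n + 1) v * x) = v 0 • kill n x - grι n (killTau n v) * top n x := by
      rw [top_apply, contr_ι_mul, map_sub, map_mul, kill_ι, map_smul, top_apply]
      rfl
    rw [h1, map_mul, kill_ι, map_mul, map_sub, map_smul, map_mul]
    conv_lhs => rw [hx, ι_eq_gen_add_emb]
    have h2 : emb n (grι n (killTau n v)) * (gen 0 * emb n (top n x)) =
        - (gen 0 * (emb n (grι n (killTau n v)) * emb n (top n x))) := by
      rw [← mul_assoc, ← mul_assoc, gen_mul, grInv_emb, grInv_ι, map_neg]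
      noncomm_ring
    rw [add_mul, mul_add, mul_add, h2, smul_mul_assoc, smul_mul_assoc, ← mul_assoc (gen 0),
      gen_mul_self, zero_mul, smul_zero, mul_sub, mul_smul_comm]
    abel

theorem top_grInv (z : Gr (n + 1)) : top n (grInv (n + 1) z) = -grInv n (top n z) := by
  rw [top_apply, contr_grInv, map_neg, ← grInv_kill, top_apply]

/-- Setting τ = 0 after the graded Leibniz rule for the contraction gives an odd Leibniz rule along
`kill`. This is the source of odd derivations along morphisms. -/
theorem top_mul (z w : Gr (n + 1)) :
    top n (z * w) = top n z * kill n w + grInv n (kill n z) * top n w := by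
  rw [top_apply, contr_mul, map_add, map_mul, map_mul, grInv_kill]
  rfl

@[simp] theorem grBody_kill (z : Gr (n + 1)) : grBody n (kill n z) = grBody (n + 1) z := by
  induction z using gr_left_induction with
  | hs r => simp
  | ha x y hx hy => simp only [map_add, hx, hy]
  | hm w x hx => simp

/-- The ideal of elements without body. -/
def soul (n : ℕ) : Submodule ℝ (Gr n) := LinearMap.ker (grBody n).toLinearMap

theorem mem_soul {z : Gr n} : z ∈ soul n ↔ grBody n z = 0 := Iff.rfl

/-- The elements without body form a nilpotent ideal. -/
theorem exists_soul_pow_eq_bot (n : ℕ) : ∃ N : ℕ, soul n ^ N = ⊥ := by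
  induction n with
  | zero =>
    refine ⟨1, ?_⟩
    rw [pow_one, eq_bot_iff]
    intro z hz
    rw [Submodule.mem_bot, eq_algebraMap_grBody z, mem_soul.1 hz, map_zero]
  | succ n ih =>
    obtain ⟨N, hN⟩ := ih
    -- Elements of the N-th power vanish under `kill`, so they are multiples of the first generator.
    -- The product of two such elements is zero since that generator squares to zero.
    refine ⟨N + N, ?_⟩
    have h1 : ∀ z ∈ soul (n + 1) ^ N, kill n z = 0 := by
      intro z hz
      have h2 : (soul (n + 1) ^ N).map (kill n).toLinearMap ≤ soul n ^ N := by
        rw [Submodule.map_pow]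
        refine pow_le_pow_left' ?_ N
        rintro _ ⟨x, hx, rfl⟩
        exact mem_soul.2 ((grBody_kill x).trans hx)
      have h3 := h2 ⟨z, hz, rfl⟩
      rw [hN] at h3
      exact h3
    rw [pow_add, eq_bot_iff, Submodule.mul_le]
    intro x hx y hy
    rw [Submodule.mem_bot, eq_emb_add_gen_mul x, eq_emb_add_gen_mul y, h1 x hx, h1 y hy, map_zero,
      zero_add, zero_add, gen_mul 0 (emb n (top n x)), mul_assoc, ← mul_assoc (gen 0),
      gen_mul_self, zero_mul, mul_zero]

end Grassmann

/-! ### Operations on superfunctions -/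

section Operations

variable {E : Type*} [NormedAddCommGroup E] [NormedSpace ℝ E] {n n' : ℕ} {U : Opens E}

theorem SuperFun.ext {f g : SuperFun n U} (h : ∀ x, f.1 x = g.1 x) : f = g :=
  Subtype.ext (funext h)

theorem differentiableAt_ext0 (f : SuperFun n U) (x : U) :
    DifferentiableAt ℝ (ext0 f.1) x :=
  (f.2.contDiffAt (U.isOpen.mem_nhds x.2)).differentiableAt (by simp)

omit [NormedSpace ℝ E] in
theorem ext0_eventuallyEq {f : U → Gr n} {g : E → Gr n} (h : ∀ x : U, f x = g x) (x : U) :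
    ext0 f =ᶠ[nhds x.1] g := by
  filter_upwards [U.isOpen.mem_nhds x.2] with y hy
  rw [ext0_apply _ hy, h]

/-- The superfunction with the given smooth values. -/
def SuperFun.mk' (g : E → Gr n) (hg : ContDiffOn ℝ ∞ g U) : SuperFun n U :=
  ⟨fun x => g x, hg.congr fun x hx => by rw [ext0_apply _ hx]⟩

/-- A constant superfunction. -/
def SuperFun.const (U : Opens E) (z : Gr n) : SuperFun n U :=
  SuperFun.mk' (fun _ => z) contDiffOn_const

@[simp] theorem SuperFun.const_apply (z : Gr n) (x : U) : (SuperFun.const U z).1 x = z := rfl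

/-- The pointwise application of a linear map of Grassmann algebras. -/
def mapGr (L : Gr n →ₗ[ℝ] Gr n') : SuperFun n U →ₗ[ℝ] SuperFun n' U where
  toFun f := ⟨fun x => L (f.1 x), by
    refine ((contDiff_gr_linearMap L).comp_contDiffOn f.2).congr ?_
    intro x hx
    rw [ext0_apply _ hx, Function.comp_apply, ext0_apply _ hx]⟩
  map_add' f g := SuperFun.ext fun x => map_add L _ _
  map_smul' c f := SuperFun.ext fun x => map_smul L c _

/-- The pointwise application of a homomorphism of Grassmann algebras. -/
def mapGrAlg (L : Gr n →ₐ[ℝ] Gr n') : SuperFun n U →ₐ[ℝ] SuperFun n' U :=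
  AlgHom.ofLinearMap (mapGr L.toLinearMap) (SuperFun.ext fun _ => map_one L)
    (fun _ _ => SuperFun.ext fun _ => map_mul L _ _)

/-- The grade involution on superfunctions. -/
def sInv : SuperFun n U →ₐ[ℝ] SuperFun n U := mapGrAlg (grInv n)

@[simp] theorem sInv_apply (f : SuperFun n U) (x : U) : (sInv f).1 x = grInv n (f.1 x) := rfl

@[simp] theorem sInv_sInv (f : SuperFun n U) : sInv (sInv f) = f :=
  SuperFun.ext fun x => grInv_grInv (f.1 x)

theorem hasParity_zero_iff {f : SuperFun n U} : HasParity 0 f ↔ sInv f = f :=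
  ⟨fun h => SuperFun.ext fun x => mem_grPart_zero_iff.1 (h x),
    fun h x => mem_grPart_zero_iff.2 (congrArg (fun f : SuperFun n U => f.1 x) h)⟩

theorem hasParity_one_iff {f : SuperFun n U} : HasParity 1 f ↔ sInv f = -f :=
  ⟨fun h => SuperFun.ext fun x => mem_grPart_one_iff.1 (h x),
    fun h x => mem_grPart_one_iff.2 (congrArg (fun f : SuperFun n U => f.1 x) h)⟩

/-- Decomposition into an even and an odd part. -/
theorem exists_parity_decomposition (f : SuperFun n U) :
    ∃ f₀ f₁ : SuperFun n U, HasParity 0 f₀ ∧ HasParity 1 f₁ ∧ f = f₀ + f₁ := by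
  refine ⟨(1 / 2 : ℝ) • (f + sInv f), (1 / 2 : ℝ) • (f - sInv f), hasParity_zero_iff.2 ?_,
    hasParity_one_iff.2 ?_, ?_⟩
  · rw [map_smul, map_add, sInv_sInv, add_comm]
  · rw [map_smul, map_sub, sInv_sInv, ← smul_neg, neg_sub]
  · module

/-- The coordinate functions of a superdomain. -/
def coord {p : ℕ} (q : ℕ) (O : Opens (Fin p → ℝ)) : Fin p ⊕ Fin q → SuperFun q O :=
  Sum.elim (evenCoord q O) (fun r => SuperFun.const O (gen r))

theorem evenCoord_apply {p q : ℕ} {O : Opens (Fin p → ℝ)} (j : Fin p) (y : O) :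
    (evenCoord q O j).1 y = algebraMap ℝ (Gr q) (y.1 j) := rfl

theorem res_coord {p q : ℕ} {O₁ O₂ : Opens (Fin p → ℝ)} (h : O₁ ≤ O₂) (c : Fin p ⊕ Fin q) :
    res h (coord q O₂ c) = coord q O₁ c := by
  cases c <;> rfl

theorem sInv_coord_inl {p q : ℕ} {O : Opens (Fin p → ℝ)} (j : Fin p) :
    sInv (coord q O (.inl j)) = coord q O (.inl j) :=
  SuperFun.ext fun _ => AlgHom.commutes _ _

theorem sInv_coord_inr {p q : ℕ} {O : Opens (Fin p → ℝ)} (r : Fin q) :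
    sInv (coord q O (.inr r)) = -coord q O (.inr r) :=
  SuperFun.ext fun _ => grInv_gen r

/-! Derivatives of superfunctions -/

/-- The multiplication of the Grassmann algebra as a continuous bilinear map. -/
def grMul (n : ℕ) : Gr n →L[ℝ] Gr n →L[ℝ] Gr n :=
  LinearMap.toContinuousLinearMap
    ((LinearMap.toContinuousLinearMap : (Gr n →ₗ[ℝ] Gr n) ≃ₗ[ℝ] (Gr n →L[ℝ] Gr n)).toLinearMap
      ∘ₗ LinearMap.mul ℝ (Gr n))

theorem evenDeriv_apply (v : E) (f : SuperFun n U) (x : U) :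
    (evenDeriv v f).1 x = fderiv ℝ (ext0 f.1) x v := rfl

theorem evenDeriv_apply_of_eq (v : E) (f : SuperFun n U) {g : E → Gr n}
    (h : ∀ x : U, f.1 x = g x) (x : U) : (evenDeriv v f).1 x = fderiv ℝ g x v := by
  rw [evenDeriv_apply, (ext0_eventuallyEq h x).fderiv_eq]

theorem evenDeriv_mul (v : E) (f g : SuperFun n U) :
    evenDeriv v (f * g) = evenDeriv v f * g + f * evenDeriv v g := by
  refine SuperFun.ext fun x => ?_
  rw [evenDeriv_apply_of_eq v (f * g) (g := fun y => grMul n (ext0 f.1 y) (ext0 g.1 y))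
    (fun y => by simp only [ext0_apply _ y.2]; rfl)]
  have h := (grMul n).hasFDerivAt_of_bilinear (differentiableAt_ext0 f x).hasFDerivAt
    (differentiableAt_ext0 g x).hasFDerivAt
  rw [h.fderiv]
  change ext0 f.1 x * (fderiv ℝ (ext0 g.1) x v) + (fderiv ℝ (ext0 f.1) x v) * ext0 g.1 x =
    (fderiv ℝ (ext0 f.1) x v) * g.1 x + f.1 x * (fderiv ℝ (ext0 g.1) x v)
  rw [ext0_apply _ x.2, ext0_apply _ x.2, add_comm]

theorem evenDeriv_mapGr (v : E) (L : Gr n →ₗ[ℝ] Gr n') (f : SuperFun n U) :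
    evenDeriv v (mapGr L f) = mapGr L (evenDeriv v f) := by
  refine SuperFun.ext fun x => ?_
  rw [evenDeriv_apply_of_eq v (mapGr L f) (g := fun y => LinearMap.toContinuousLinearMap L
    (ext0 f.1 y)) (fun y => by simp only [ext0_apply _ y.2]; rfl)]
  have h := (LinearMap.toContinuousLinearMap L).hasFDerivAt.comp x.1
    (differentiableAt_ext0 f x).hasFDerivAt
  exact congrArg (fun T : E →L[ℝ] Gr n' => T v) h.fderiv

theorem evenDeriv_sInv (v : E) (f : SuperFun n U) : evenDeriv v (sInv f) = sInv (evenDeriv v f) :=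
  evenDeriv_mapGr v (grInv n).toLinearMap f

theorem evenDeriv_res {U₁ U₂ : Opens E} (h : U₁ ≤ U₂) (v : E) (f : SuperFun n U₂) :
    evenDeriv v (res h f) = res h (evenDeriv v f) :=
  SuperFun.ext fun x => evenDeriv_apply_of_eq v _
    (fun y => (ext0_apply f.1 (h y.2)).symm) x

theorem evenDeriv_const (v : E) (z : Gr n) : evenDeriv v (SuperFun.const U z) = 0 :=
  SuperFun.ext fun x => by
    rw [evenDeriv_apply_of_eq v _ (g := fun _ => z) (fun _ => rfl), fderiv_fun_const]
    rfl

theorem oddDeriv_mul (r : Fin n) (f g : SuperFun n U) :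
    oddDeriv r (f * g) = oddDeriv r f * g + sInv f * oddDeriv r g :=
  SuperFun.ext fun x => contr_mul _ (f.1 x) (g.1 x)

theorem oddDeriv_sInv (r : Fin n) (f : SuperFun n U) : oddDeriv r (sInv f) = -sInv (oddDeriv r f) :=
  SuperFun.ext fun x => contr_grInv _ (f.1 x)

/-- The derivative with respect to a coordinate. -/
def coordDeriv {p q : ℕ} {O : Opens (Fin p → ℝ)} :
    Fin p ⊕ Fin q → (SuperFun q O →ₗ[ℝ] SuperFun q O) :=
  Sum.elim (fun j => evenDeriv (Pi.single j 1)) oddDeriv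

theorem coordDeriv_res {p q : ℕ} {O₁ O₂ : Opens (Fin p → ℝ)} (h : O₁ ≤ O₂) (c : Fin p ⊕ Fin q)
    (f : SuperFun q O₂) : coordDeriv c (res h f) = res h (coordDeriv c f) := by
  cases c with
  | inl j => exact evenDeriv_res h _ f
  | inr r => rfl

theorem coordDeriv_coord {p q : ℕ} {O : Opens (Fin p → ℝ)} (c d : Fin p ⊕ Fin q) :
    coordDeriv c (coord q O d) = if c = d then 1 else 0 := by
  refine SuperFun.ext fun y => ?_
  rcases c with j | r <;> rcases d with k | s
  · change (evenDeriv (Pi.single j 1) (evenCoord q O k)).1 y = _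
    rw [evenDeriv_apply_of_eq _ _ (g := fun y => (LinearMap.toContinuousLinearMap
      (Algebra.linearMap ℝ (Gr q) ∘ₗ LinearMap.proj k)) y) (fun _ => rfl),
      ContinuousLinearMap.fderiv]
    simp only [LinearMap.coe_toContinuousLinearMap', LinearMap.comp_apply, LinearMap.proj_apply,
      Algebra.linearMap_apply, Pi.single_apply, Sum.inl.injEq, eq_comm (a := k)]
    split_ifs <;> simp
  · change (evenDeriv (Pi.single j 1) (SuperFun.const O (gen s))).1 y = _
    rw [evenDeriv_const]
    simp
  · change contr (LinearMap.proj r) (algebraMap ℝ (Gr q) (y.1 k)) = _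
    rw [contr_algebraMap]
    simp
  · change contr (LinearMap.proj r) (gen s) = _
    have h := contr_ι_mul (LinearMap.proj r) (Pi.single s (1 : ℝ)) 1
    rw [mul_one] at h
    rw [gen, h, ← map_one (algebraMap ℝ (Gr q)), contr_algebraMap, mul_zero, sub_zero, map_one]
    simp only [LinearMap.proj_apply, Pi.single_apply, Sum.inr.injEq]
    split_ifs <;> simp

end Operations

/-! ### Derivations which vanish on the coordinates -/

section Vanishing

variable {E : Type*} [NormedAddCommGroup E] [NormedSpace ℝ E] {n p q : ℕ} {U : Opens E}
  {W : Opens (Fin p → ℝ)}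

/-- A linear map along `b` which satisfies a Leibniz rule and vanishes on the coordinates is
zero. -/
theorem eq_zero_of_leibniz (b : C(U, W))
    (D : ∀ O : Opens (Fin p → ℝ), O ≤ W → (SuperFun q O →ₗ[ℝ] SuperFun n (preim b O)))
    (A C : ∀ O : Opens (Fin p → ℝ), O ≤ W → SuperFun q O → SuperFun n (preim b O))
    (hnat : ∀ (O₁ O₂ : Opens (Fin p → ℝ)) (h₁ : O₁ ≤ W) (h₂ : O₂ ≤ W) (h : O₁ ≤ O₂)
      (f : SuperFun q O₂), res (preim_mono b h) (D O₂ h₂ f) = D O₁ h₁ (res h f))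
    (hleib : ∀ O hO f g, D O hO (f * g) = D O hO f * A O hO g + C O hO f * D O hO g)
    (hA : ∀ O hO, A O hO 1 = 1) (hC : ∀ O hO, C O hO 1 = 1)
    (hbody : ∀ O hO f (x : preim b O), grBody n ((C O hO f).1 x) =
      grBody q (f.1 ⟨(b ⟨x.1, x.2.1⟩).1, x.2.2⟩))
    (hcoord : ∀ c, D W le_rfl (coord q W c) = 0) :
    ∀ O hO f, D O hO f = 0 := by
  have hcoord' : ∀ O hO c, D O hO (coord q O c) = 0 := by
    intro O hO c
    rw [← res_coord hO, ← hnat O W hO le_rfl hO, hcoord, map_zero]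
  have hone : ∀ O hO, D O hO 1 = 0 := by
    intro O hO
    have h := hleib O hO 1 1
    rw [hA, hC, mul_one, mul_one, one_mul] at h
    exact left_eq_add.1 h
  have hscalar : ∀ O hO (r : ℝ), D O hO (algebraMap ℝ _ r) = 0 := by
    intro O hO r
    rw [Algebra.algebraMap_eq_smul_one, map_smul, hone, smul_zero]
  have hconst : ∀ O hO (z : Gr q), D O hO (SuperFun.const O z) = 0 := by
    intro O hO z
    induction z using gr_left_induction with
    | hs r => exact hscalar O hO r
    | ha x y hx hy =>
      rw [show SuperFun.const O (x + y) = SuperFun.const O x + SuperFun.const O y from rfl,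
        map_add, hx, hy, add_zero]
    | hm v x hx =>
      have h1 : SuperFun.const O (grι q v) = ∑ r, v r • coord q O (.inr r) := by
        refine SuperFun.ext fun y => ?_
        have h2 : v = ∑ r, v r • (Pi.single r (1 : ℝ) : Fin q → ℝ) := by
          ext j
          simp [Finset.sum_apply, Pi.single_apply]
        rw [AddSubmonoidClass.coe_finsetSum, Finset.sum_apply, SuperFun.const_apply]
        conv_lhs => rw [h2, map_sum]
        exact Finset.sum_congr rfl fun r _ => map_smul _ _ _
      rw [show SuperFun.const O (grι q v * x) = SuperFun.const O (grι q v) * SuperFun.const O x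
        from rfl, hleib, hx, mul_zero, add_zero, h1, map_sum]
      simp only [map_smul, hcoord', smul_zero, Finset.sum_const_zero, zero_mul]
  -- The zeroth power of a submodule is the line of scalars. The factor ⊤ makes the claim for k = 0
  -- trivially true and the submodules into left multiples of powers of the soul.
  have key : ∀ (k : ℕ) O hO f (x : preim b O), (D O hO f).1 x ∈ soul n ^ k * ⊤ := by
    intro k
    induction k with
    | zero =>
      intro O hO f x
      rw [pow_zero, one_mul]
      trivial
    | succ k ih =>
      intro O hO f x
      set c : Fin p → ℝ := (b ⟨x.1, x.2.1⟩).1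
      obtain ⟨r, hr, hball⟩ := Metric.isOpen_iff.1 O.isOpen c x.2.2
      set B : Opens (Fin p → ℝ) := ⟨Metric.ball c r, Metric.isOpen_ball⟩
      have hBO : B ≤ O := hball
      have hxB : x.1 ∈ preim b B := ⟨x.2.1, Metric.mem_ball_self hr⟩
      -- Near the image point c, f is a constant plus a combination of the functions yᵢ − cᵢ. The
      -- operator kills the constant and each yᵢ − cᵢ, so only the terms C(yᵢ − cᵢ) · D(gᵢ) survive.
      obtain ⟨g, hg, hfg⟩ := exists_hadamard (f.2.mono hBO : ContDiffOn ℝ ∞ (ext0 f.1) B)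
      set G : Fin p → SuperFun q B := fun i => SuperFun.mk' (g i) (hg i)
      have h1 : res hBO f = SuperFun.const B (ext0 f.1 c) +
          ∑ i, (coord q B (.inl i) - algebraMap ℝ _ (c i)) * G i := by
        refine SuperFun.ext fun y => ?_
        change f.1 ⟨y.1, hBO y.2⟩ = ext0 f.1 c + (∑ i, _ : SuperFun q B).1 y
        rw [← ext0_apply f.1 (hBO y.2), hfg y.1 y.2, AddSubmonoidClass.coe_finsetSum,
          Finset.sum_apply]
        congr 1
        refine Finset.sum_congr rfl fun i _ => ?_
        rw [Algebra.smul_def, map_sub]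
        rfl
      have h2 : (D O hO f).1 x = (D B (hBO.trans hO) (res hBO f)).1 ⟨x.1, hxB⟩ := by
        rw [← hnat B O (hBO.trans hO) hO hBO]
        rfl
      rw [h2, h1, map_add, hconst, zero_add, map_sum, AddSubmonoidClass.coe_finsetSum,
        Finset.sum_apply]
      refine Submodule.sum_mem _ fun i _ => ?_
      rw [hleib, map_sub, hcoord', hscalar, sub_zero, zero_mul, zero_add, pow_succ', mul_assoc]
      -- The body of C(yᵢ − cᵢ) at x is the value of yᵢ − cᵢ at c, which is zero. This gains one
      -- power of the soul over the induction hypothesis for gᵢ.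
      refine Submodule.mul_mem_mul (mem_soul.2 ?_) (ih B (hBO.trans hO) (G i) ⟨x.1, hxB⟩)
      rw [hbody]
      change grBody q (algebraMap ℝ _ (c i) - algebraMap ℝ _ (c i)) = 0
      rw [sub_self, map_zero]
  intro O hO f
  obtain ⟨N, hN⟩ := exists_soul_pow_eq_bot n
  refine SuperFun.ext fun x => ?_
  have h := key N O hO f x
  rw [hN, Submodule.bot_mul, Submodule.mem_bot] at h
  exact h

end Vanishing

/-! ### Morphisms over a fixed map of the bodies -/

section MorOver

variable {E E' : Type*} [NormedAddCommGroup E] [NormedSpace ℝ E] [NormedAddCommGroup E']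
  [NormedSpace ℝ E'] {n q : ℕ} {U : Opens E} {W : Opens E'} {b : C(U, W)}

/-- The pull-backs of a morphism of superdomains with the underlying map `b`; parity is expressed
by the grade involution. -/
@[ext]
structure MorOver (n q : ℕ) (b : C(U, W)) where
  /-- the pull-back of superfunctions -/
  pull : ∀ O : Opens E', O ≤ W → (SuperFun q O →ₐ[ℝ] SuperFun n (preim b O))
  /-- pull-backs commute with the grade involution -/
  pull_sInv : ∀ (O : Opens E') (hO : O ≤ W) (f : SuperFun q O),
    pull O hO (sInv f) = sInv (pull O hO f)
  /-- pull-backs commute with restrictions -/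
  natural : ∀ (O₁ O₂ : Opens E') (h₁ : O₁ ≤ W) (h₂ : O₂ ≤ W) (h : O₁ ≤ O₂) (f : SuperFun q O₂),
    res (preim_mono b h) (pull O₂ h₂ f) = pull O₁ h₁ (res h f)

/-- Splitting f into its even and odd parts converts the parity conditions on homogeneous elements
into commutation with the grade involution on all elements. -/
theorem map_sInv_of_parity {U' : Opens E'} {L : SuperFun q U' →ₗ[ℝ] SuperFun n U}
    (h₀ : ∀ f, HasParity 0 f → HasParity 0 (L f)) (h₁ : ∀ f, HasParity 1 f → HasParity 1 (L f))
    (f : SuperFun q U') : L (sInv f) = sInv (L f) := by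
  obtain ⟨f₀, f₁, hf₀, hf₁, rfl⟩ := exists_parity_decomposition f
  simp only [map_add]
  rw [hasParity_zero_iff.1 hf₀, hasParity_one_iff.1 hf₁, hasParity_zero_iff.1 (h₀ _ hf₀), map_neg,
    hasParity_one_iff.1 (h₁ _ hf₁)]

theorem map_sInv_of_parity_shift {U' : Opens E'} {L : SuperFun q U' →ₗ[ℝ] SuperFun n U}
    (h₀ : ∀ f, HasParity 0 f → HasParity 1 (L f)) (h₁ : ∀ f, HasParity 1 f → HasParity 0 (L f))
    (f : SuperFun q U') : L (sInv f) = -sInv (L f) := by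
  obtain ⟨f₀, f₁, hf₀, hf₁, rfl⟩ := exists_parity_decomposition f
  simp only [map_add]
  rw [hasParity_zero_iff.1 hf₀, hasParity_one_iff.1 hf₁, hasParity_one_iff.1 (h₀ _ hf₀), map_neg,
    hasParity_zero_iff.1 (h₁ _ hf₁)]
  abel

/-- The pull-backs of a morphism. -/
def SuperMor.over (F : SuperMor n q U W) : MorOver n q F.body where
  pull := F.pull
  pull_sInv O hO f := map_sInv_of_parity (L := (F.pull O hO).toLinearMap) (F.parity O hO 0)
    (F.parity O hO 1) f
  natural := F.natural

/-- The morphism with the given pull-backs. -/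
def MorOver.toMor (A : MorOver n q b) : SuperMor n q U W where
  body := b
  pull := A.pull
  parity O hO i f hf := by
    fin_cases i
    · exact hasParity_zero_iff.2 (by rw [← A.pull_sInv, hasParity_zero_iff.1 hf])
    · exact hasParity_one_iff.2 (by rw [← A.pull_sInv, hasParity_one_iff.1 hf, map_neg])
  natural := A.natural

/-- The type of the pull-backs depends on the body. Once the bodies of two morphisms are known to
agree, this moves both into the single type `MorOver n q b`. -/
theorem SuperMor.exists_toMor_eq (F : SuperMor n q U W) (h : F.body = b) :
    ∃ A : MorOver n q b, A.toMor = F := by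
  subst h
  exact ⟨F.over, rfl⟩

/-- A natural family of linear maps along `b`. -/
@[ext]
structure LinOver (n q : ℕ) (b : C(U, W)) where
  /-- the map on the superfunctions on an open set -/
  app : ∀ O : Opens E', O ≤ W → (SuperFun q O →ₗ[ℝ] SuperFun n (preim b O))
  /-- compatibility with restrictions -/
  natural : ∀ (O₁ O₂ : Opens E') (h₁ : O₁ ≤ W) (h₂ : O₂ ≤ W) (h : O₁ ≤ O₂) (f : SuperFun q O₂),
    res (preim_mono b h) (app O₂ h₂ f) = app O₁ h₁ (res h f)

/-- The family `D` is an odd derivation along the morphism `A`. -/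
structure IsOddDer (A : MorOver n q b) (D : LinOver n q b) : Prop where
  leibniz : ∀ O hO f g,
    D.app O hO (f * g) = D.app O hO f * A.pull O hO g + A.pull O hO (sInv f) * D.app O hO g
  map_sInv : ∀ O hO f, D.app O hO (sInv f) = -sInv (D.app O hO f)

/-- The restriction of a morphism to the locus where the first odd coordinate vanishes. -/
def MorOver.kill (F : MorOver (n + 1) q b) : MorOver n q b where
  pull O hO := (mapGrAlg (SuperFlow.kill n)).comp (F.pull O hO)
  pull_sInv O hO f := by
    refine SuperFun.ext fun x => ?_
    rw [AlgHom.comp_apply, F.pull_sInv]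
    exact (grInv_kill _).symm
  natural O₁ O₂ h₁ h₂ h f := SuperFun.ext fun x =>
    congrArg (fun k : SuperFun (n + 1) (preim b O₁) => SuperFlow.kill n (k.1 x))
      (F.natural O₁ O₂ h₁ h₂ h f)

/-- The coefficient of the first odd coordinate in a morphism. -/
def MorOver.top (F : MorOver (n + 1) q b) : LinOver n q b where
  app O hO := mapGr (SuperFlow.top n) ∘ₗ (F.pull O hO).toLinearMap
  natural O₁ O₂ h₁ h₂ h f := SuperFun.ext fun x =>
    congrArg (fun k : SuperFun (n + 1) (preim b O₁) => SuperFlow.top n (k.1 x))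
      (F.natural O₁ O₂ h₁ h₂ h f)

theorem MorOver.kill_pull_apply (F : MorOver (n + 1) q b) {O : Opens E'} (hO : O ≤ W)
    (f : SuperFun q O) (x : preim b O) :
    (F.kill.pull O hO f).1 x = SuperFlow.kill n ((F.pull O hO f).1 x) := rfl

theorem MorOver.top_app_apply (F : MorOver (n + 1) q b) {O : Opens E'} (hO : O ≤ W)
    (f : SuperFun q O) (x : preim b O) :
    (F.top.app O hO f).1 x = SuperFlow.top n ((F.pull O hO f).1 x) := rfl

theorem MorOver.isOddDer_top (F : MorOver (n + 1) q b) : IsOddDer F.kill F.top where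
  leibniz O hO f g := by
    refine SuperFun.ext fun x => ?_
    rw [F.kill.pull_sInv]
    change SuperFlow.top n ((F.pull O hO (f * g)).1 x) = _
    rw [map_mul]
    exact top_mul _ _
  map_sInv O hO f := by
    refine SuperFun.ext fun x => ?_
    rw [F.top_app_apply, F.pull_sInv]
    exact top_grInv _

/-- The element of `Λ ℝⁿ⁺¹` with given restriction and given first odd coefficient. -/
def grGlue (a d : Gr n) : Gr (n + 1) := emb n a + gen 0 * emb n d

theorem top_grGlue (a d : Gr n) : top n (grGlue a d) = d := by
  rw [grGlue, map_add, top_emb, top_gen_mul, kill_emb, zero_add]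

theorem kill_grGlue (a d : Gr n) : kill n (grGlue a d) = a := by
  rw [grGlue, map_add, map_mul, kill_emb, kill_gen_zero, zero_mul, add_zero]

/-- Expand (a + τ d)(a' + τ d'): moving τ to the left of a applies the grade involution to a, and
the term with two factors τ vanishes. Thus multiplicativity of a glued map is exactly the odd
Leibniz rule. -/
theorem grGlue_mul (a a' d d' : Gr n) :
    grGlue (a * a') (d * a' + grInv n a * d') = grGlue a d * grGlue a' d' := by
  simp only [grGlue, map_add, map_mul, ← grInv_emb]
  generalize emb n a = a
  generalize emb n a' = a'
  generalize emb n d = d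
  generalize emb n d' = d'
  have h3 : gen 0 * d * (gen 0 * d') = 0 := by
    rw [gen_mul 0 d, mul_assoc, ← mul_assoc (gen 0), gen_mul_self, zero_mul, mul_zero]
  have h4 : gen 0 * (grInv (n + 1) a * d') = a * (gen 0 * d') := by
    rw [← mul_assoc, gen_mul, grInv_grInv, mul_assoc]
  rw [mul_add, h4, add_mul, mul_add, mul_add, h3]
  noncomm_ring

theorem grInv_grGlue (a d : Gr n) :
    grInv (n + 1) (grGlue a d) = grGlue (grInv n a) (-grInv n d) := by
  simp only [grGlue, map_add, map_mul, grInv_emb, grInv_gen, map_neg, neg_mul, mul_neg]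

/-- Pointwise gluing of superfunctions. -/
def sGlue (f g : SuperFun n U) : SuperFun (n + 1) U :=
  mapGr (emb n).toLinearMap f + mapGr (LinearMap.mulLeft ℝ (gen 0) ∘ₗ (emb n).toLinearMap) g

theorem sGlue_apply (f g : SuperFun n U) (x : U) : (sGlue f g).1 x = grGlue (f.1 x) (g.1 x) := rfl

theorem sGlue_one : sGlue (1 : SuperFun n U) 0 = 1 :=
  SuperFun.ext fun x => by
    change grGlue 1 0 = 1
    rw [grGlue, map_one, map_zero, mul_zero, add_zero]

theorem sGlue_mul (f f' g g' : SuperFun n U) :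
    sGlue (f * f') (g * f' + sInv f * g') = sGlue f g * sGlue f' g' :=
  SuperFun.ext fun x => grGlue_mul (f.1 x) (f'.1 x) (g.1 x) (g'.1 x)

theorem sInv_sGlue (f g : SuperFun n U) : sInv (sGlue f g) = sGlue (sInv f) (-sInv g) :=
  SuperFun.ext fun x => grInv_grGlue (f.1 x) (g.1 x)

theorem superFun_neg_mul (f g : SuperFun n U) : -f * g = -(f * g) := neg_mul f g

/-- The linear map glued from two linear maps. -/
def glueLin {U' : Opens E'} (L D : SuperFun q U' →ₗ[ℝ] SuperFun n U) :
    SuperFun q U' →ₗ[ℝ] SuperFun (n + 1) U :=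
  mapGr (emb n).toLinearMap ∘ₗ L +
    mapGr (LinearMap.mulLeft ℝ (gen 0) ∘ₗ (emb n).toLinearMap) ∘ₗ D

theorem glueLin_apply {U' : Opens E'} (L D : SuperFun q U' →ₗ[ℝ] SuperFun n U)
    (f : SuperFun q U') : glueLin L D f = sGlue (L f) (D f) := rfl

/-- The algebra homomorphism glued from a homomorphism and an odd derivation along it. -/
def glueAlg {U' : Opens E'} (L : SuperFun q U' →ₐ[ℝ] SuperFun n U)
    (D : SuperFun q U' →ₗ[ℝ] SuperFun n U)
    (h : ∀ f g, D (f * g) = D f * L g + sInv (L f) * D g) :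
    SuperFun q U' →ₐ[ℝ] SuperFun (n + 1) U :=
  AlgHom.ofLinearMap (glueLin L.toLinearMap D)
    (by
      have h1 : D 1 = 0 := by simpa using h 1 1
      rw [glueLin_apply, h1, AlgHom.toLinearMap_apply, map_one, sGlue_one])
    (fun f g => by
      rw [glueLin_apply, glueLin_apply, glueLin_apply, h, AlgHom.toLinearMap_apply, map_mul,
        sGlue_mul]
      rfl)

theorem glueAlg_apply {U' : Opens E'} (L : SuperFun q U' →ₐ[ℝ] SuperFun n U)
    (D : SuperFun q U' →ₗ[ℝ] SuperFun n U)
    (h : ∀ f g, D (f * g) = D f * L g + sInv (L f) * D g) (f : SuperFun q U') :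
    glueAlg L D h f = sGlue (L f) (D f) := rfl

/-- The morphism with a given restriction to the locus where the first odd coordinate vanishes,
and a given coefficient of this coordinate. -/
def MorOver.glue (A : MorOver n q b) (D : LinOver n q b) (h : IsOddDer A D) :
    MorOver (n + 1) q b where
  pull O hO := glueAlg (A.pull O hO) (D.app O hO)
    (fun f g => by rw [h.leibniz, A.pull_sInv])
  pull_sInv O hO f := by
    rw [glueAlg_apply, glueAlg_apply, A.pull_sInv, h.map_sInv, sInv_sGlue]
  natural O₁ O₂ h₁ h₂ h f := by
    rw [glueAlg_apply, glueAlg_apply, ← A.natural O₁ O₂ h₁ h₂ h, ← D.natural O₁ O₂ h₁ h₂ h]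
    rfl

theorem MorOver.glue_pull (A : MorOver n q b) (D : LinOver n q b) (h : IsOddDer A D)
    {O : Opens E'} (hO : O ≤ W) (f : SuperFun q O) :
    (A.glue D h).pull O hO f = sGlue (A.pull O hO f) (D.app O hO f) := rfl

theorem gr_succ_ext {z w : Gr (n + 1)} (h₁ : kill n z = kill n w) (h₂ : top n z = top n w) :
    z = w := by
  rw [eq_emb_add_gen_mul z, eq_emb_add_gen_mul w, h₁, h₂]

theorem MorOver.kill_glue (A : MorOver n q b) (D : LinOver n q b) (h : IsOddDer A D) :
    (A.glue D h).kill = A := by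
  refine MorOver.ext (funext fun O => funext fun hO => AlgHom.ext fun f => SuperFun.ext fun x => ?_)
  rw [MorOver.kill_pull_apply, MorOver.glue_pull, sGlue_apply, kill_grGlue]

theorem MorOver.top_glue (A : MorOver n q b) (D : LinOver n q b) (h : IsOddDer A D) :
    (A.glue D h).top = D := by
  refine LinOver.ext (funext fun O => funext fun hO => LinearMap.ext fun f =>
    SuperFun.ext fun x => ?_)
  rw [MorOver.top_app_apply, MorOver.glue_pull, sGlue_apply, top_grGlue]

theorem MorOver.ext_of_kill_top {F G : MorOver (n + 1) q b} (h₁ : F.kill = G.kill)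
    (h₂ : F.top = G.top) : F = G := by
  refine MorOver.ext (funext fun O => funext fun hO => AlgHom.ext fun f => SuperFun.ext fun x =>
    gr_succ_ext ?_ ?_)
  · rw [← F.kill_pull_apply, ← G.kill_pull_apply, h₁]
  · rw [← F.top_app_apply, ← G.top_app_apply, h₂]

/-- Morphisms are compatible with the underlying real functions. -/
theorem MorOver.grBody_pull (A : MorOver n q b) {O : Opens E'} (hO : O ≤ W) (f : SuperFun q O)
    (x : preim b O) :
    grBody n ((A.pull O hO f).1 x) = grBody q (f.1 ⟨(b ⟨x.1, x.2.1⟩).1, x.2.2⟩) := by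
  set y : O := ⟨(b ⟨x.1, x.2.1⟩).1, x.2.2⟩
  by_contra hne
  set r := grBody n ((A.pull O hO f).1 x)
  -- If the bodies differed, f minus the constant r would have nonzero body at the image point y,
  -- hence would be invertible near it. Its pull-back, however, has body zero at x, which no unit
  -- can have.
  set g : SuperFun q O := f - algebraMap ℝ _ r with hg
  have hbg : ContDiffOn ℝ ∞ (fun z => grBody q (ext0 g.1 z)) O :=
    ContDiff.comp_contDiffOn (g := (grBody q : Gr q → ℝ))
      (LinearMap.toContinuousLinearMap (grBody q).toLinearMap).contDiff g.2
  have hgy : grBody q (ext0 g.1 y) ≠ 0 := by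
    rw [ext0_apply _ y.2]
    change grBody q (f.1 y - algebraMap ℝ _ r) ≠ 0
    rw [map_sub, AlgHom.commutes, sub_ne_zero]
    exact fun h => hne h.symm
  obtain ⟨S, hS, hSo, hyS⟩ : ∃ S ⊆ {z | z ∈ O ∧ grBody q (ext0 g.1 z) ≠ 0}, IsOpen S ∧ y.1 ∈ S := by
    have h1 := (hbg.continuousOn.continuousAt (O.isOpen.mem_nhds y.2)).eventually_ne hgy
    exact mem_nhds_iff.1 ((O.isOpen.eventually_mem y.2).and h1)
  set Q : Opens E' := ⟨S, hSo⟩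
  have hQO : Q ≤ O := fun z hz => (hS hz).1
  set u : SuperFun q Q := ofSmooth (fun z => (grBody q (ext0 g.1 z))⁻¹)
    ((hbg.mono hQO).inv fun z hz => (hS hz).2)
  -- Multiplied by the inverse of its body, g becomes 1 minus an element without body, and such
  -- elements are nilpotent.
  have hnil : IsNilpotent (1 - u * res hQO g) := by
    obtain ⟨N, hN⟩ := exists_soul_pow_eq_bot q
    refine ⟨N, SuperFun.ext fun z => ?_⟩
    have h1 : (1 - u * res hQO g).1 z ∈ soul q := by
      rw [mem_soul]
      change grBody q (1 - algebraMap ℝ _ ((grBody q (ext0 g.1 z))⁻¹) * g.1 ⟨z, hQO z.2⟩) = 0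
      rw [map_sub, map_mul, AlgHom.commutes, map_one, ← ext0_apply g.1 (hQO z.2)]
      exact sub_eq_zero.2 (inv_mul_cancel₀ (hS z.2).2).symm
    have h2 : ((1 - u * res hQO g).1 z) ^ N ∈ soul q ^ N := Submodule.pow_mem_pow _ h1 N
    rw [hN, Submodule.mem_bot] at h2
    exact h2
  have hunit : IsUnit (u * res hQO g) := by
    have := hnil.isUnit_one_sub
    rwa [sub_sub_cancel] at this
  obtain ⟨v, hv⟩ := hunit.exists_left_inv
  have hxQ : x.1 ∈ preim b Q := ⟨x.2.1, hyS⟩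
  have h1 := congrArg (fun k => grBody n ((A.pull Q (hQO.trans hO) k).1 ⟨x.1, hxQ⟩)) hv
  have h2 : (A.pull Q (hQO.trans hO) (res hQO g)).1 ⟨x.1, hxQ⟩ = (A.pull O hO g).1 x := by
    rw [← A.natural Q O (hQO.trans hO) hO hQO]
    rfl
  have h3 : grBody n ((A.pull O hO g).1 x) = 0 := by
    rw [hg, map_sub, AlgHom.commutes]
    change grBody n ((A.pull O hO f).1 x - algebraMap ℝ _ r) = 0
    rw [map_sub, AlgHom.commutes]
    exact sub_self r
  simp only [map_mul, map_one] at h1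
  change grBody n (_ * (_ * (A.pull Q (hQO.trans hO) (res hQO g)).1 ⟨x.1, hxQ⟩)) =
    grBody n 1 at h1
  rw [map_mul, map_mul, h2, h3, mul_zero, mul_zero, map_one] at h1
  exact zero_ne_one h1

end MorOver

/-! ### Derivations along a morphism and coordinates -/

section OddDer

variable {E : Type*} [NormedAddCommGroup E] [NormedSpace ℝ E] {n p q : ℕ} {U : Opens E}
  {W : Opens (Fin p → ℝ)} {b : C(U, W)}

/-- Odd derivations along a morphism are determined by their values on the coordinates. -/
theorem IsOddDer.ext {A : MorOver n q b} {D₁ D₂ : LinOver n q b} (h₁ : IsOddDer A D₁)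
    (h₂ : IsOddDer A D₂)
    (h : ∀ c, D₁.app W le_rfl (coord q W c) = D₂.app W le_rfl (coord q W c)) : D₁ = D₂ := by
  have key := eq_zero_of_leibniz b (fun O hO => D₁.app O hO - D₂.app O hO)
    (fun O hO f => A.pull O hO f) (fun O hO f => A.pull O hO (sInv f))
    (fun O₁ O₂ k₁ k₂ k f => by
      rw [LinearMap.sub_apply, LinearMap.sub_apply, map_sub, D₁.natural O₁ O₂ k₁ k₂,
        D₂.natural O₁ O₂ k₁ k₂])
    (fun O hO f g => by
      simp only [LinearMap.sub_apply, h₁.leibniz, h₂.leibniz, mul_sub, sub_mul]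
      abel)
    (fun O hO => map_one _) (fun O hO => by simp)
    (fun O hO f x => by
      rw [A.grBody_pull, sInv_apply, grBody_grInv])
    (fun c => by rw [LinearMap.sub_apply, h c, sub_self])
  exact LinOver.ext (funext fun O => funext fun hO => LinearMap.ext fun f =>
    sub_eq_zero.1 (key O hO f))

/-- The values on the coordinates of an odd derivation have the opposite parity. -/
def OddOnCoords {p q : ℕ} {P : Opens E} (β : Fin p ⊕ Fin q → SuperFun n P) : Prop :=
  (∀ j, sInv (β (.inl j)) = -β (.inl j)) ∧ ∀ r, sInv (β (.inr r)) = β (.inr r)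

/-- The derivation along a morphism with given values on the coordinates. -/
def derOfCoords (A : MorOver n q b) (β : Fin p ⊕ Fin q → SuperFun n (preim b W)) :
    LinOver n q b where
  app O hO := ∑ c, LinearMap.mulLeft ℝ (res (preim_mono b hO) (β c)) ∘ₗ
    (A.pull O hO).toLinearMap ∘ₗ coordDeriv c
  natural O₁ O₂ h₁ h₂ h f := by
    simp only [LinearMap.sum_apply, LinearMap.comp_apply, LinearMap.mulLeft_apply,
      AlgHom.toLinearMap_apply, map_sum, map_mul, A.natural O₁ O₂ h₁ h₂ h, coordDeriv_res]
    rfl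

theorem derOfCoords_app (A : MorOver n q b) (β : Fin p ⊕ Fin q → SuperFun n (preim b W))
    {O : Opens (Fin p → ℝ)} (hO : O ≤ W) (f : SuperFun q O) :
    (derOfCoords A β).app O hO f =
      ∑ c, res (preim_mono b hO) (β c) * A.pull O hO (coordDeriv c f) := by
  simp [derOfCoords]

/-- The two kinds of coordinates balance separately. For even coordinates the coefficient is odd and
moves past A f at the cost of the grade involution, while the partial derivative is even. For odd
coordinates the coefficient is central, while the partial derivative itself produces the involution.
-/
theorem isOddDer_derOfCoords (A : MorOver n q b) {β : Fin p ⊕ Fin q → SuperFun n (preim b W)}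
    (hβ : OddOnCoords β) : IsOddDer A (derOfCoords A β) where
  leibniz O hO f g := by
    simp only [derOfCoords_app, Finset.sum_mul, Finset.mul_sum, ← Finset.sum_add_distrib]
    refine Finset.sum_congr rfl fun c _ => ?_
    rcases c with j | r
    · have h1 : ∀ k : SuperFun n (preim b O), res (preim_mono b hO) (β (.inl j)) * k =
          sInv k * res (preim_mono b hO) (β (.inl j)) := fun k => SuperFun.ext fun x =>
        mul_comm_of_odd (congrArg (fun k : SuperFun n (preim b W) =>
          k.1 ⟨x.1, preim_mono b hO x.2⟩) (hβ.1 j)) (k.1 x)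
      change _ * A.pull O hO (evenDeriv (Pi.single j 1) (f * g)) = _ * A.pull O hO
        (evenDeriv (Pi.single j 1) f) * _ + _ * (_ * A.pull O hO (evenDeriv (Pi.single j 1) g))
      rw [evenDeriv_mul, map_add, mul_add, map_mul, map_mul, ← mul_assoc, ← mul_assoc,
        h1 (A.pull O hO f), A.pull_sInv]
      simp only [mul_assoc]
    · have h1 : ∀ k : SuperFun n (preim b O), res (preim_mono b hO) (β (.inr r)) * k =
          k * res (preim_mono b hO) (β (.inr r)) := fun k => SuperFun.ext fun x =>
        mul_comm_of_even (congrArg (fun k : SuperFun n (preim b W) =>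
          k.1 ⟨x.1, preim_mono b hO x.2⟩) (hβ.2 r)) (k.1 x)
      change _ * A.pull O hO (oddDeriv r (f * g)) = _ * A.pull O hO
        (oddDeriv r f) * _ + _ * (_ * A.pull O hO (oddDeriv r g))
      rw [oddDeriv_mul, map_add, mul_add, map_mul, map_mul, ← mul_assoc, ← mul_assoc,
        h1 (A.pull O hO (sInv f))]
      simp only [mul_assoc]
  map_sInv O hO f := by
    have hneg₁ : ∀ k l : SuperFun n (preim b O), -(-k * l) = k * l := fun k l => by
      rw [superFun_neg_mul, neg_neg]
    have hneg₂ : ∀ k l : SuperFun n (preim b O), k * -l = -(k * l) := fun k l => mul_neg k l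
    simp only [derOfCoords_app, map_sum, map_mul, ← Finset.sum_neg_distrib]
    refine Finset.sum_congr rfl fun c _ => ?_
    have h2 : ∀ c, sInv (res (preim_mono b hO) (β c)) = res (preim_mono b hO) (sInv (β c)) :=
      fun c => rfl
    rcases c with j | r
    · change _ * A.pull O hO (evenDeriv (Pi.single j 1) (sInv f)) = -(_ * sInv
        (A.pull O hO (evenDeriv (Pi.single j 1) f)))
      rw [evenDeriv_sInv, A.pull_sInv, h2, hβ.1, map_neg]
      exact (hneg₁ _ _).symm
    · change _ * A.pull O hO (oddDeriv r (sInv f)) = -(_ * sInv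
        (A.pull O hO (oddDeriv r f)))
      rw [oddDeriv_sInv, map_neg, A.pull_sInv, h2, hβ.2]
      exact hneg₂ _ _

theorem derOfCoords_coord (A : MorOver n q b) (β : Fin p ⊕ Fin q → SuperFun n (preim b W))
    (c : Fin p ⊕ Fin q) : (derOfCoords A β).app W le_rfl (coord q W c) = β c := by
  rw [derOfCoords_app, Finset.sum_eq_single c]
  · rw [coordDeriv_coord, if_pos rfl, map_one, mul_one]
    rfl
  · intro d _ hd
    rw [coordDeriv_coord, if_neg hd, map_zero, mul_zero]
  · exact fun h => (h (Finset.mem_univ c)).elim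

theorem IsOddDer.oddOnCoords {A : MorOver n q b} {D : LinOver n q b} (h : IsOddDer A D) :
    OddOnCoords fun c => D.app W le_rfl (coord q W c) := by
  refine ⟨fun j => ?_, fun r => ?_⟩
  · have h1 := h.map_sInv W le_rfl (coord q W (.inl j))
    rw [sInv_coord_inl] at h1
    exact (neg_eq_iff_eq_neg.2 h1).symm
  · have h1 := h.map_sInv W le_rfl (coord q W (.inr r))
    rw [sInv_coord_inr, map_neg] at h1
    exact (neg_injective h1).symm

/-- This is the chain rule for odd derivations along A: both sides are odd derivations along A with
the same values on the coordinates. -/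
theorem IsOddDer.eq_derOfCoords {A : MorOver n q b} {D : LinOver n q b} (h : IsOddDer A D) :
    D = derOfCoords A fun c => D.app W le_rfl (coord q W c) :=
  h.ext (isOddDer_derOfCoords A h.oddOnCoords) fun c =>
    (derOfCoords_coord A (fun c => D.app W le_rfl (coord q W c)) c).symm

end OddDer

/-! ### Super vector fields -/

section SuperDer

variable {E : Type*} [NormedAddCommGroup E] [NormedSpace ℝ E] {q : ℕ} {W : Opens E}

theorem SuperDer.app_mul_even (X : SuperDer q 0 W) {O : Opens E} (hO : O ≤ W)
    (f g : SuperFun q O) : X.app O hO (f * g) = X.app O hO f * g + f * X.app O hO g := by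
  obtain ⟨f₀, f₁, hf₀, hf₁, rfl⟩ := exists_parity_decomposition f
  rw [add_mul, map_add, X.leibniz O hO 0 f₀ g hf₀, X.leibniz O hO 1 f₁ g hf₁, map_add]
  simp only [ZMod.val_zero, zero_mul, pow_zero, one_smul]
  noncomm_ring

theorem SuperDer.app_sInv_even (X : SuperDer q 0 W) {O : Opens E} (hO : O ≤ W)
    (f : SuperFun q O) : X.app O hO (sInv f) = sInv (X.app O hO f) :=
  map_sInv_of_parity (X.parity O hO 0) (X.parity O hO 1) f

/-- The grade involution absorbs the sign, so that the Leibniz rule holds for inhomogeneous f as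
well. -/
theorem SuperDer.app_mul_odd (X : SuperDer q 1 W) {O : Opens E} (hO : O ≤ W)
    (f g : SuperFun q O) : X.app O hO (f * g) = X.app O hO f * g + sInv f * X.app O hO g := by
  obtain ⟨f₀, f₁, hf₀, hf₁, rfl⟩ := exists_parity_decomposition f
  rw [add_mul, map_add, X.leibniz O hO 0 f₀ g hf₀, X.leibniz O hO 1 f₁ g hf₁, map_add, map_add,
    hasParity_zero_iff.1 hf₀, hasParity_one_iff.1 hf₁]
  have h1 : (1 : ZMod 2).val = 1 := rfl
  simp only [ZMod.val_zero, mul_zero, pow_zero, one_smul, h1, mul_one, pow_one, neg_smul, add_mul, superFun_neg_mul]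
  abel

theorem SuperDer.app_sInv_odd (X : SuperDer q 1 W) {O : Opens E} (hO : O ≤ W)
    (f : SuperFun q O) : X.app O hO (sInv f) = -sInv (X.app O hO f) :=
  map_sInv_of_parity_shift (X.parity O hO 0) (X.parity O hO 1) f

end SuperDer

/-! ### Even flows -/

section Flows

variable {m n p q : ℕ} {U : Opens (Fin m → ℝ)} {W : Opens (Fin p → ℝ)}
  {V : Opens (ℝ × (Fin m → ℝ))} {b : C(V, W)} {β : C(U, W)} {t₀ : ℝ}

/-- The time derivative of superfunctions. -/
def timeDeriv {P : Opens (ℝ × (Fin m → ℝ))} : SuperFun n P →ₗ[ℝ] SuperFun n P :=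
  evenDeriv ((1 : ℝ), (0 : Fin m → ℝ))

theorem timeDeriv_apply_eq {P : Opens (ℝ × (Fin m → ℝ))} {f : SuperFun n P}
    {g : ℝ × (Fin m → ℝ) → Gr n} (h : ∀ x : P, f.1 x = g x) {v : P} {d : Gr n}
    (hg : DifferentiableAt ℝ g v) (hd : HasDerivAt (fun s => g (s, v.1.2)) d v.1.1) :
    (timeDeriv f).1 v = d := by
  have h1 : (timeDeriv f).1 v = _ := evenDeriv_apply_of_eq _ f h v
  have h2 : HasDerivAt (fun s : ℝ => (s, v.1.2)) ((1 : ℝ), (0 : Fin m → ℝ)) v.1.1 :=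
    (hasDerivAt_id _).prodMk (hasDerivAt_const _ _)
  have h3 := hg.hasFDerivAt.comp_hasDerivAt v.1.1 h2
  rw [h1]
  exact h3.unique hd

theorem hasDerivAt_time {P : Opens (ℝ × (Fin m → ℝ))} (f : SuperFun n P) (v : P) :
    HasDerivAt (fun s => ext0 f.1 (s, v.1.2)) ((timeDeriv f).1 v) v.1.1 := by
  have h2 : HasDerivAt (fun s : ℝ => (s, v.1.2)) ((1 : ℝ), (0 : Fin m → ℝ)) v.1.1 :=
    (hasDerivAt_id _).prodMk (hasDerivAt_const _ _)
  exact (differentiableAt_ext0 f v).hasFDerivAt.comp_hasDerivAt v.1.1 h2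

/-- The morphism `A` solves the flow equation of the even derivation `X`. -/
def IsEvenFlow (X : SuperDer q 0 W) (A : MorOver n q b) : Prop :=
  ∀ O hO f, timeDeriv (A.pull O hO f) = A.pull O hO (X.app O hO f)

/-- The domain `V` over `U` and the map `b` on it satisfy the requirements for a flow with initial
condition `β` at the time `t₀`, apart from the flow equation. -/
structure IsFlowBody (b : C(V, W)) (β : C(U, W)) (t₀ : ℝ) : Prop where
  mem_of_mem : ∀ v ∈ V, v.2 ∈ U
  initial_mem : ∀ x ∈ U, (t₀, x) ∈ V
  interval : ∀ x ∈ U, OrdConnected {t : ℝ | (t, x) ∈ V}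
  initial : ∀ x : U, b ⟨(t₀, x.1), initial_mem x.1 x.2⟩ = β x

theorem IsFlowBody.mem_preim (hb : IsFlowBody b β t₀) {O : Opens (Fin p → ℝ)}
    {x : Fin m → ℝ} (hx : x ∈ preim β O) : (t₀, x) ∈ preim b O :=
  ⟨hb.initial_mem x hx.1, by rw [hb.initial ⟨x, hx.1⟩]; exact hx.2⟩

theorem mem_preim_top {v : ℝ × (Fin m → ℝ)} (hv : v ∈ V) : v ∈ preim b W :=
  ⟨hv, (b ⟨v, hv⟩).2⟩

/-- The restriction of `A` to the time `t₀` is `φ`. -/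
def HasInit (hb : IsFlowBody b β t₀) (A : MorOver n q b) (φ : MorOver n q β) : Prop :=
  ∀ O hO f (x : preim β O),
    (A.pull O hO f).1 ⟨(t₀, x.1), hb.mem_preim x.2⟩ = (φ.pull O hO f).1 x

/-! The linear equation for the coordinates of an odd derivation along a flow -/

/-- The coefficients of the linear equation for the coordinates of an odd derivation. -/
def odeCoeff (X : SuperDer q 0 W) (A : MorOver n q b) (d c : Fin p ⊕ Fin q) :
    SuperFun n (preim b W) :=
  A.pull W le_rfl (coordDeriv c (X.app W le_rfl (coord q W d)))

/-- The linear equation for the coordinates of an odd derivation along a flow. -/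
def CoordODE (X : SuperDer q 0 W) (A : MorOver n q b)
    (f : Fin p ⊕ Fin q → SuperFun n (preim b W)) : Prop :=
  ∀ d, timeDeriv (f d) = ∑ c, f c * odeCoeff X A d c

/-- A matrix with entries in the Grassmann algebra, acting from the right. -/
def matAct (n : ℕ) (ι : Type) [Fintype ι] : (ι → ι → Gr n) →ₗ[ℝ] ((ι → Gr n) →L[ℝ] (ι → Gr n)) :=
  (LinearMap.toContinuousLinearMap :
    ((ι → Gr n) →ₗ[ℝ] (ι → Gr n)) ≃ₗ[ℝ] ((ι → Gr n) →L[ℝ] (ι → Gr n))).toLinearMap ∘ₗ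
  LinearMap.mk₂ ℝ (fun (a : ι → ι → Gr n) (k : ι → Gr n) => fun d => ∑ c, k c * a d c)
    (fun a a' k => by
      ext1 d
      simp only [Pi.add_apply, mul_add, Finset.sum_add_distrib])
    (fun r a k => by
      ext1 d
      simp only [Pi.smul_apply, mul_smul_comm, Finset.smul_sum])
    (fun a k k' => by
      ext1 d
      simp only [Pi.add_apply, add_mul, Finset.sum_add_distrib])
    (fun r a k => by
      ext1 d
      simp only [Pi.smul_apply, smul_mul_assoc, Finset.smul_sum])

theorem matAct_apply {ι : Type} [Fintype ι] (a : ι → ι → Gr n) (k : ι → Gr n) (d : ι) :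
    matAct n ι a k d = ∑ c, k c * a d c := rfl

/-- The coefficient operator of the equation `CoordODE`. -/
def odeOp (X : SuperDer q 0 W) (A : MorOver n q b) (v : ℝ × (Fin m → ℝ)) :
    (Fin p ⊕ Fin q → Gr n) →L[ℝ] (Fin p ⊕ Fin q → Gr n) :=
  matAct n (Fin p ⊕ Fin q) fun d c => ext0 (odeCoeff X A d c).1 v

theorem contDiffOn_odeOp (X : SuperDer q 0 W) (A : MorOver n q b) :
    ContDiffOn ℝ ∞ (odeOp X A) V := by
  have h1 : ContDiff ℝ ∞ (matAct n (Fin p ⊕ Fin q)) :=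
    (LinearMap.toContinuousLinearMap (matAct n (Fin p ⊕ Fin q))).contDiff
  refine h1.comp_contDiffOn (contDiffOn_pi.2 fun d => contDiffOn_pi.2 fun c => ?_)
  exact (odeCoeff X A d c).2.mono fun v hv => mem_preim_top hv

theorem odeOp_apply (X : SuperDer q 0 W) (A : MorOver n q b)
    (f : Fin p ⊕ Fin q → SuperFun n (preim b W)) (v : preim b W) (d : Fin p ⊕ Fin q) :
    odeOp X A v (fun c => (f c).1 v) d = (∑ c, f c * odeCoeff X A d c).1 v := by
  rw [odeOp, matAct_apply, AddSubmonoidClass.coe_finsetSum, Finset.sum_apply]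
  refine Finset.sum_congr rfl fun c _ => ?_
  rw [ext0_apply _ v.2]
  rfl

theorem IsFlowBody.segment_mem (hb : IsFlowBody b β t₀) {v : ℝ × (Fin m → ℝ)} (hv : v ∈ V)
    {s : ℝ} (hs : s ∈ unitInterval) : (t₀ + s * (v.1 - t₀), v.2) ∈ V := by
  have h1 := hb.mem_of_mem v hv
  have h2 := (hb.interval v.2 h1).convex.add_smul_sub_mem (hb.initial_mem v.2 h1) hv hs
  exact h2

/-- The time-fibres of V are intervals around t₀, so V contains the segments needed to solve a
linear equation over all of it. -/
theorem exists_coordODE (hb : IsFlowBody b β t₀) (X : SuperDer q 0 W) (A : MorOver n q b)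
    (f₀ : Fin p ⊕ Fin q → SuperFun n (preim β W)) :
    ∃ f : Fin p ⊕ Fin q → SuperFun n (preim b W), CoordODE X A f ∧
      ∀ c (x : preim β W), (f c).1 ⟨(t₀, x.1), hb.mem_preim x.2⟩ = (f₀ c).1 x := by
  have hβ : ∀ x ∈ U, x ∈ preim β W := fun x hx => ⟨hx, (β ⟨x, hx⟩).2⟩
  have hu₀ : ContDiffOn ℝ ∞ (fun v : ℝ × (Fin m → ℝ) => fun c => ext0 (f₀ c).1 v.2) V :=
    contDiffOn_pi.2 fun c => (f₀ c).2.comp contDiff_snd.contDiffOn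
      fun v hv => hβ _ (hb.mem_of_mem v hv)
  obtain ⟨u, hu, hinit, hode⟩ := exists_linear_flow (u₀ := fun x c => ext0 (f₀ c).1 x) V.isOpen
    (contDiffOn_odeOp X A) (fun z hz s hs => hb.segment_mem hz hs) hu₀
  have huc : ∀ c, ContDiffOn ℝ ∞ (fun v => u v c) (preim b W) := fun c =>
    (contDiffOn_pi.1 hu c).mono fun v hv => hv.1
  refine ⟨fun c => SuperFun.mk' (fun v => u v c) (huc c), fun d => SuperFun.ext fun v => ?_,
    fun c x => ?_⟩
  · refine timeDeriv_apply_eq (g := fun v => u v d) (fun _ => rfl)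
      (((huc d).contDiffAt ((preim b W).isOpen.mem_nhds v.2)).differentiableAt (by simp)) ?_
    have h1 := hasDerivAt_pi.1 (hode v.1.1 v.1.2 v.2.1) d
    rw [← odeOp_apply X A _ v d]
    exact h1
  · change u (t₀, x.1) c = _
    rw [hinit x.1 (hb.initial_mem _ x.2.1)]
    exact ext0_apply _ x.2

theorem coordODE_unique (hb : IsFlowBody b β t₀) {X : SuperDer q 0 W} {A : MorOver n q b}
    {f g : Fin p ⊕ Fin q → SuperFun n (preim b W)} (hf : CoordODE X A f) (hg : CoordODE X A g)
    (h : ∀ c (x : preim β W), (f c).1 ⟨(t₀, x.1), hb.mem_preim x.2⟩ =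
      (g c).1 ⟨(t₀, x.1), hb.mem_preim x.2⟩) : f = g := by
  funext c
  refine SuperFun.ext fun v => ?_
  have hxU : v.1.2 ∈ U := hb.mem_of_mem _ v.2.1
  have hxW : v.1.2 ∈ preim β W := ⟨hxU, (β ⟨_, hxU⟩).2⟩
  have hI : IsOpen {t : ℝ | (t, v.1.2) ∈ V} := V.isOpen.preimage (by fun_prop)
  have hM : ContinuousOn (fun t : ℝ => odeOp X A (t, v.1.2)) {t : ℝ | (t, v.1.2) ∈ V} :=
    (contDiffOn_odeOp X A).continuousOn.comp (f := fun t : ℝ => (t, v.1.2)) (by fun_prop)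
      fun t ht => ht
  have hder : ∀ f : Fin p ⊕ Fin q → SuperFun n (preim b W), CoordODE X A f →
      ∀ t ∈ {t : ℝ | (t, v.1.2) ∈ V},
        HasDerivAt (fun s => fun c => ext0 (f c).1 (s, v.1.2))
          (odeOp X A (t, v.1.2) (fun c => ext0 (f c).1 (t, v.1.2))) t := by
    intro f hf t ht
    have htW : (t, v.1.2) ∈ preim b W := mem_preim_top ht
    refine hasDerivAt_pi.2 fun d => ?_
    have h1 := hasDerivAt_time (f d) ⟨(t, v.1.2), htW⟩
    rw [hf d, ← odeOp_apply] at h1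
    have h2 : (fun c => ext0 (f c).1 (t, v.1.2)) = fun c => (f c).1 ⟨(t, v.1.2), htW⟩ :=
      funext fun c => ext0_apply _ htW
    rw [h2]
    exact h1
  have h0 : (fun c => ext0 (f c).1 (t₀, v.1.2)) = fun c => ext0 (g c).1 (t₀, v.1.2) := by
    funext c
    rw [ext0_apply _ (hb.mem_preim hxW), ext0_apply _ (hb.mem_preim hxW)]
    exact h c ⟨_, hxW⟩
  have h1 := linear_ode_unique hI (hb.interval _ hxU) hM (hb.initial_mem _ hxU) (hder f hf)
    (hder g hg) h0 v.2.1
  have h2 := congrFun h1 c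
  change ext0 (f c).1 v.1 = ext0 (g c).1 v.1 at h2
  rwa [ext0_apply _ v.2, ext0_apply _ v.2] at h2

/-- The sign of a coordinate. -/
def coordSign {p q : ℕ} : Fin p ⊕ Fin q → ℝ := Sum.elim (fun _ => 1) (fun _ => -1)

theorem coordSign_mul_self (c : Fin p ⊕ Fin q) : coordSign c * coordSign c = 1 := by
  cases c <;> simp [coordSign]

theorem sInv_coord {O : Opens (Fin p → ℝ)} (c : Fin p ⊕ Fin q) :
    sInv (coord q O c) = coordSign c • coord q O c := by
  cases c with
  | inl j => rw [sInv_coord_inl]; exact (one_smul ℝ _).symm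
  | inr r => rw [sInv_coord_inr]; exact (neg_one_smul ℝ _).symm

theorem coordDeriv_sInv {O : Opens (Fin p → ℝ)} (c : Fin p ⊕ Fin q) (f : SuperFun q O) :
    sInv (coordDeriv c f) = coordSign c • coordDeriv c (sInv f) := by
  cases c with
  | inl j => exact (evenDeriv_sInv _ f).symm.trans (one_smul ℝ _).symm
  | inr r =>
    have h := oddDeriv_sInv r f
    exact (neg_eq_iff_eq_neg.2 h).symm.trans (neg_one_smul ℝ _).symm

/-- The parity condition says that f is fixed by a signed grade involution. In this form it can be
proved by uniqueness of solutions. -/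
theorem oddOnCoords_iff {P : Opens (ℝ × (Fin m → ℝ))} {f : Fin p ⊕ Fin q → SuperFun n P} :
    OddOnCoords f ↔ ∀ c, f c = -(coordSign c • sInv (f c)) := by
  constructor
  · rintro ⟨h₁, h₂⟩ (j | r)
    · rw [h₁]
      change _ = -((1 : ℝ) • _)
      rw [one_smul, neg_neg]
    · rw [h₂]
      change _ = -((-1 : ℝ) • _)
      rw [neg_one_smul, neg_neg]
  · intro h
    refine ⟨fun j => ?_, fun r => ?_⟩
    · have h1 : f (.inl j) = -((1 : ℝ) • sInv (f (.inl j))) := h (.inl j)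
      rw [one_smul] at h1
      exact (neg_eq_iff_eq_neg.2 h1).symm
    · have h1 : f (.inr r) = -((-1 : ℝ) • sInv (f (.inr r))) := h (.inr r)
      rw [neg_one_smul, neg_neg] at h1
      exact h1.symm

/-- The coefficient matrix is even as a supermatrix because X is even: an entry is odd exactly when
its two indices have different parities. -/
theorem sInv_odeCoeff (X : SuperDer q 0 W) (A : MorOver n q b) (d c : Fin p ⊕ Fin q) :
    sInv (odeCoeff X A d c) = (coordSign c * coordSign d) • odeCoeff X A d c := by
  rw [odeCoeff, ← A.pull_sInv, coordDeriv_sInv, ← X.app_sInv_even, sInv_coord]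
  simp only [map_smul, smul_smul]

/-- The parity of the initial values propagates along the linear equation. -/
theorem CoordODE.oddOnCoords (hb : IsFlowBody b β t₀) {X : SuperDer q 0 W} {A : MorOver n q b}
    {f : Fin p ⊕ Fin q → SuperFun n (preim b W)} (hf : CoordODE X A f)
    {f₀ : Fin p ⊕ Fin q → SuperFun n (preim β W)} (hf₀ : OddOnCoords f₀)
    (h : ∀ c (x : preim β W), (f c).1 ⟨(t₀, x.1), hb.mem_preim x.2⟩ = (f₀ c).1 x) :
    OddOnCoords f := by
  -- The signed grade involution maps solutions to solutions. The image of f has the same initial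
  -- values as f, so it equals f.
  have hg : CoordODE X A fun c => -(coordSign c • sInv (f c)) := by
    intro d
    have h1 : timeDeriv (sInv (f d)) = sInv (timeDeriv (f d)) := evenDeriv_sInv _ _
    rw [map_neg, map_smul, h1, hf d, map_sum, Finset.smul_sum, ← Finset.sum_neg_distrib]
    refine Finset.sum_congr rfl fun c _ => ?_
    rw [map_mul, sInv_odeCoeff, superFun_neg_mul, mul_smul_comm, smul_smul, smul_mul_assoc,
      mul_left_comm, coordSign_mul_self, mul_one]
  have h2 := coordODE_unique hb hf hg (fun c x => by
    rw [h c x]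
    change _ = -(coordSign c • grInv n ((f c).1 ⟨(t₀, x.1), hb.mem_preim x.2⟩))
    rw [h c x]
    rcases c with j | r
    · have h3 : grInv n ((f₀ (.inl j)).1 x) = -(f₀ (.inl j)).1 x :=
        congrArg (fun k : SuperFun n (preim β W) => k.1 x) (hf₀.1 j)
      rw [h3]
      change _ = -((1 : ℝ) • _)
      rw [one_smul, neg_neg]
    · have h3 : grInv n ((f₀ (.inr r)).1 x) = (f₀ (.inr r)).1 x :=
        congrArg (fun k : SuperFun n (preim β W) => k.1 x) (hf₀.2 r)
      rw [h3]
      change _ = -((-1 : ℝ) • _)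
      rw [neg_one_smul, neg_neg])
  exact oddOnCoords_iff.2 fun c => congrFun h2 c

/-! The induction on the number of odd coordinates -/

theorem IsEvenFlow.kill {X : SuperDer q 0 W} {F : MorOver (n + 1) q b} (hF : IsEvenFlow X F) :
    IsEvenFlow X F.kill := fun O hO f =>
  (evenDeriv_mapGr _ (SuperFlow.kill n).toLinearMap (F.pull O hO f)).trans
    (congrArg (mapGr (SuperFlow.kill n).toLinearMap) (hF O hO f))

theorem IsEvenFlow.timeDeriv_top {X : SuperDer q 0 W} {F : MorOver (n + 1) q b}
    (hF : IsEvenFlow X F) (O hO f) :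
    timeDeriv (F.top.app O hO f) = F.top.app O hO (X.app O hO f) :=
  (evenDeriv_mapGr _ (SuperFlow.top n) (F.pull O hO f)).trans
    (congrArg (mapGr (SuperFlow.top n)) (hF O hO f))

theorem HasInit.kill {hb : IsFlowBody b β t₀} {F : MorOver (n + 1) q b}
    {φ : MorOver (n + 1) q β} (h : HasInit hb F φ) : HasInit hb F.kill φ.kill :=
  fun O hO f x => congrArg (SuperFlow.kill n) (h O hO f x)

theorem HasInit.top {hb : IsFlowBody b β t₀} {F : MorOver (n + 1) q b}
    {φ : MorOver (n + 1) q β} (h : HasInit hb F φ) (O hO f) (x : preim β O) :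
    (F.top.app O hO f).1 ⟨(t₀, x.1), hb.mem_preim x.2⟩ = (φ.top.app O hO f).1 x :=
  congrArg (SuperFlow.top n) (h O hO f x)

/-- Taking the coefficient of the generator number 0 in the flow equation gives ∂_t D = D ∘ X. The
chain rule then expands D(X d) for each coordinate d in terms of the values of D on the coordinates.
-/
theorem IsEvenFlow.coordODE_top {X : SuperDer q 0 W} {F : MorOver (n + 1) q b}
    (hF : IsEvenFlow X F) :
    CoordODE X F.kill fun c => F.top.app W le_rfl (coord q W c) := by
  intro d
  rw [hF.timeDeriv_top]
  conv_lhs => rw [F.isOddDer_top.eq_derOfCoords]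
  rw [derOfCoords_app]
  rfl

/-- Even flows are unique. -/
theorem IsEvenFlow.unique {X : SuperDer q 0 W} (hb : IsFlowBody b β t₀) :
    ∀ {n : ℕ} {φ : MorOver n q β} {F G : MorOver n q b}, IsEvenFlow X F → IsEvenFlow X G →
      HasInit hb F φ → HasInit hb G φ → F = G := by
  intro n
  induction n with
  | zero =>
    -- Without odd parameters the Grassmann algebra is ℝ, so a morphism is determined by its
    -- underlying map b.
    intro φ F G _ _ _ _
    refine MorOver.ext (funext fun O => funext fun hO => AlgHom.ext fun f =>
      SuperFun.ext fun x => ?_)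
    rw [eq_algebraMap_grBody ((F.pull O hO f).1 x), eq_algebraMap_grBody ((G.pull O hO f).1 x),
      F.grBody_pull, G.grBody_pull]
  | succ n ih =>
    intro φ F G hF hG hFφ hGφ
    have hk : F.kill = G.kill := ih hF.kill hG.kill hFφ.kill hGφ.kill
    -- The linear equation depends only on the restriction `kill`. The induction hypothesis
    -- identifies the two restrictions, so both sets of coefficients solve the same initial value
    -- problem.
    have hFo := hF.coordODE_top
    rw [hk] at hFo
    have hc := coordODE_unique hb hFo hG.coordODE_top (fun c x => by
      rw [hFφ.top, hGφ.top])
    refine MorOver.ext_of_kill_top hk ?_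
    rw [F.isOddDer_top.eq_derOfCoords, G.isOddDer_top.eq_derOfCoords, hc, hk]

theorem IsOddDer.app_eq_zero {A : MorOver n q b} {D : LinOver n q b} (h : IsOddDer A D)
    (hc : ∀ c, D.app W le_rfl (coord q W c) = 0) (O hO f) : D.app O hO f = 0 := by
  rw [h.eq_derOfCoords, derOfCoords_app]
  simp [hc]

/-- The failure of an odd derivation along a flow to satisfy the flow equation. -/
def flowDefect (X : SuperDer q 0 W) (D : LinOver n q b) : LinOver n q b where
  app O hO := timeDeriv ∘ₗ D.app O hO - D.app O hO ∘ₗ X.app O hO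
  natural O₁ O₂ h₁ h₂ h f := by
    have h3 : timeDeriv (res (preim_mono b h) (D.app O₂ h₂ f)) =
      res (preim_mono b h) (timeDeriv (D.app O₂ h₂ f)) := evenDeriv_res _ _ _
    simp only [LinearMap.sub_apply, LinearMap.comp_apply, map_sub]
    rw [← h3, D.natural O₁ O₂ h₁ h₂ h, D.natural O₁ O₂ h₁ h₂ h, X.natural O₁ O₂ h₁ h₂ h]

theorem flowDefect_app (X : SuperDer q 0 W) (D : LinOver n q b) (O hO f) :
    (flowDefect X D).app O hO f = timeDeriv (D.app O hO f) - D.app O hO (X.app O hO f) := rfl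

/-- This is a commutator of D with an even derivation, ∂_t on the source and X on the target. The
mixed terms of the Leibniz rule cancel because A intertwines ∂_t and X. -/
theorem isOddDer_flowDefect {X : SuperDer q 0 W} {A : MorOver n q b} (hA : IsEvenFlow X A)
    {D : LinOver n q b} (hD : IsOddDer A D) : IsOddDer A (flowDefect X D) where
  leibniz O hO f g := by
    have hmul : ∀ k l : SuperFun n (preim b O),
      timeDeriv (k * l) = timeDeriv k * l + k * timeDeriv l := fun k l => evenDeriv_mul _ k l
    simp only [flowDefect_app]
    rw [hD.leibniz, map_add, hmul, hmul, hA, hA, X.app_mul_even, map_add, hD.leibniz, hD.leibniz,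
      ← X.app_sInv_even, sub_mul, mul_sub]
    abel
  map_sInv O hO f := by
    have h1 : ∀ k : SuperFun n (preim b O), timeDeriv (sInv k) = sInv (timeDeriv k) :=
      fun k => evenDeriv_sInv _ k
    simp only [flowDefect_app]
    rw [hD.map_sInv, map_neg, h1, X.app_sInv_even, hD.map_sInv, map_sub]
    abel

/-- The inductive step for the existence of even flows. -/
theorem exists_evenFlow_succ {X : SuperDer q 0 W} (hb : IsFlowBody b β t₀) (φ : MorOver (n + 1) q β)
    {A : MorOver n q b} (hA : IsEvenFlow X A) (hAφ : HasInit hb A φ.kill) :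
    ∃ F : MorOver (n + 1) q b, IsEvenFlow X F ∧ HasInit hb F φ := by
  obtain ⟨f, hf, hf₀⟩ := exists_coordODE hb X A fun c => φ.top.app W le_rfl (coord q W c)
  have hodd : OddOnCoords f := hf.oddOnCoords hb φ.isOddDer_top.oddOnCoords hf₀
  have hD := isOddDer_derOfCoords A hodd
  have hflow : ∀ O hO g, timeDeriv ((derOfCoords A f).app O hO g) =
      (derOfCoords A f).app O hO (X.app O hO g) := by
    intro O hO g
    -- On the coordinates the vanishing of the defect is precisely the linear equation solved by f.
    -- The chain rule extends it to all superfunctions.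
    refine sub_eq_zero.1 ((isOddDer_flowDefect hA hD).app_eq_zero (fun d => ?_) O hO g)
    rw [flowDefect_app, derOfCoords_coord, hf d, derOfCoords_app]
    exact sub_self _
  refine ⟨A.glue _ hD, fun O hO g => ?_, fun O hO g x => ?_⟩
  · rw [MorOver.glue_pull, MorOver.glue_pull, ← hA, ← hflow, sGlue, map_add]
    exact congrArg₂ (· + ·) (evenDeriv_mapGr _ _ _) (evenDeriv_mapGr _ _ _)
  · rw [MorOver.glue_pull, sGlue_apply, hAφ]
    refine gr_succ_ext ?_ ?_
    · rw [kill_grGlue]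
      rfl
    · rw [top_grGlue, ← φ.top_app_apply]
      conv_rhs => rw [φ.isOddDer_top.eq_derOfCoords]
      rw [derOfCoords_app, derOfCoords_app, AddSubmonoidClass.coe_finsetSum, Finset.sum_apply,
        AddSubmonoidClass.coe_finsetSum, Finset.sum_apply]
      refine Finset.sum_congr rfl fun c _ => ?_
      have h1 := hAφ O hO (coordDeriv c g) x
      have h2 := hf₀ c ⟨x.1, preim_mono β hO x.2⟩
      exact congrArg₂ (· * ·) h2 h1

end Flows

/-! ### The flow of the body -/

section BodyFlow

variable {m n p q : ℕ} {U : Opens (Fin m → ℝ)} {W : Opens (Fin p → ℝ)}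
  {V : Opens (ℝ × (Fin m → ℝ))} {b : C(V, W)} {β : C(U, W)} {t₀ : ℝ}
  {H : ℝ × (Fin m → ℝ) → (Fin p → ℝ)}

/-- The morphism of ordinary domains given by a smooth map. -/
def bodyMor (q : ℕ) (hH : ContDiffOn ℝ ∞ H V) (hbH : ∀ v : V, (b v).1 = H v) : MorOver 0 q b where
  pull O hO :=
    { toFun := fun f => ⟨fun v =>
          algebraMap ℝ (Gr 0) (grBody q (f.1 ⟨(b ⟨v.1, v.2.1⟩).1, v.2.2⟩)), by
        have h1 : ContDiffOn ℝ ∞ (ext0 f.1 ∘ H) (preim b O) :=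
          f.2.comp (hH.mono fun v hv => hv.1) fun v hv => by
            rw [← hbH ⟨v, hv.1⟩]; exact hv.2
        have h2 : ContDiff ℝ ∞ fun z : Gr q => algebraMap ℝ (Gr 0) (grBody q z) :=
          contDiff_gr_linearMap (Algebra.linearMap ℝ (Gr 0) ∘ₗ (grBody q).toLinearMap)
        refine (h2.comp_contDiffOn h1).congr fun v hv => ?_
        rw [ext0_apply _ hv, Function.comp_apply, Function.comp_apply, ← hbH ⟨v, hv.1⟩,
          ext0_apply _ hv.2]⟩
      map_one' := SuperFun.ext fun v => by
        change algebraMap ℝ (Gr 0) (grBody q 1) = 1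
        rw [map_one, map_one]
      map_mul' := fun f g => SuperFun.ext fun v => by
        change algebraMap ℝ (Gr 0) (grBody q (_ * _)) = _ * _
        rw [map_mul, map_mul]
      map_zero' := SuperFun.ext fun v => by
        change algebraMap ℝ (Gr 0) (grBody q 0) = 0
        rw [map_zero, map_zero]
      map_add' := fun f g => SuperFun.ext fun v => by
        change algebraMap ℝ (Gr 0) (grBody q (_ + _)) = _ + _
        rw [map_add, map_add]
      commutes' := fun r => SuperFun.ext fun v => by
        change algebraMap ℝ (Gr 0) (grBody q (algebraMap ℝ _ r)) = algebraMap ℝ _ r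
        rw [AlgHom.commutes]
        rfl }
  pull_sInv O hO f := SuperFun.ext fun v => by
    change algebraMap ℝ (Gr 0) (grBody q (grInv q _)) = grInv 0 (algebraMap ℝ (Gr 0) _)
    rw [grBody_grInv, AlgHom.commutes]
  natural _ _ _ _ _ _ := rfl

theorem bodyMor_apply (hH : ContDiffOn ℝ ∞ H V) (hbH : ∀ v : V, (b v).1 = H v)
    {O : Opens (Fin p → ℝ)} (hO : O ≤ W) (f : SuperFun q O) (v : preim b O) :
    ((bodyMor q hH hbH).pull O hO f).1 v =
      algebraMap ℝ (Gr 0) (grBody q (f.1 ⟨(b ⟨v.1, v.2.1⟩).1, v.2.2⟩)) := rfl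

/-- The flow of the body defines an even flow without odd parameters. -/
theorem isEvenFlow_bodyMor (X : SuperVectorField q W) (hH : ContDiffOn ℝ ∞ H V)
    (hbH : ∀ v : V, (b v).1 = H v)
    (hflow : ∀ t x, (t, x) ∈ V → HasDerivAt (fun s => H (s, x)) (reducedField X (H (t, x))) t) :
    IsEvenFlow X.even (bodyMor q hH hbH) := by
  set A := bodyMor q hH hbH with hA
  have hmul : ∀ (P : Opens (ℝ × (Fin m → ℝ))) (k l : SuperFun 0 P),
      timeDeriv (k * l) = timeDeriv k * l + k * timeDeriv l := fun P k l => evenDeriv_mul _ k l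
  -- The difference ∂_t A − A ∘ X₀ satisfies a Leibniz rule along A, so testing it on coordinates
  -- suffices. On the even ones it vanishes by the classical flow equation.
  have key := eq_zero_of_leibniz b
    (fun O hO => timeDeriv ∘ₗ (A.pull O hO).toLinearMap -
      (A.pull O hO).toLinearMap ∘ₗ X.even.app O hO)
    (fun O hO f => A.pull O hO f) (fun O hO f => A.pull O hO f)
    (fun O₁ O₂ h₁ h₂ h f => by
      have h3 : timeDeriv (res (preim_mono b h) (A.pull O₂ h₂ f)) =
        res (preim_mono b h) (timeDeriv (A.pull O₂ h₂ f)) := evenDeriv_res _ _ _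
      simp only [LinearMap.sub_apply, LinearMap.comp_apply, AlgHom.toLinearMap_apply, map_sub]
      rw [← h3, A.natural O₁ O₂ h₁ h₂ h, A.natural O₁ O₂ h₁ h₂ h, X.even.natural O₁ O₂ h₁ h₂ h])
    (fun O hO f g => by
      simp only [LinearMap.sub_apply, LinearMap.comp_apply, AlgHom.toLinearMap_apply]
      rw [map_mul, hmul, X.even.app_mul_even, map_add, map_mul, map_mul, sub_mul, mul_sub]
      abel)
    (fun O hO => map_one _) (fun O hO => map_one _)
    (fun O hO f x => A.grBody_pull hO f x)
    (fun c => by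
      simp only [LinearMap.sub_apply, LinearMap.comp_apply, AlgHom.toLinearMap_apply]
      refine SuperFun.ext fun v => sub_eq_zero.2 ?_
      rw [hA, bodyMor_apply]
      have hbv : (b ⟨v.1, v.2.1⟩).1 = H v.1 := hbH ⟨v.1, v.2.1⟩
      rcases c with j | r
      · refine timeDeriv_apply_eq (g := fun w => algebraMap ℝ (Gr 0) (H w j)) (fun w => ?_) ?_ ?_
        · rw [bodyMor_apply]
          change algebraMap ℝ (Gr 0) (grBody q (algebraMap ℝ _ ((b ⟨w.1, w.2.1⟩).1 j))) = _
          rw [AlgHom.commutes, hbH ⟨w.1, w.2.1⟩]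
          rfl
        · have h1 : DifferentiableAt ℝ H v.1 :=
            (hH.contDiffAt (V.isOpen.mem_nhds v.2.1)).differentiableAt (by simp)
          exact (LinearMap.toContinuousLinearMap (Algebra.linearMap ℝ (Gr 0))).differentiableAt.comp
            v.1 (differentiableAt_pi.1 h1 j)
        · have h1 := hasDerivAt_pi.1 (hflow v.1.1 v.1.2 v.2.1) j
          have h2 := (LinearMap.toContinuousLinearMap
            (Algebra.linearMap ℝ (Gr 0))).hasFDerivAt.comp_hasDerivAt v.1.1 h1
          refine h2.congr_deriv ?_
          change algebraMap ℝ (Gr 0) (reducedField X (H v.1) j) = _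
          rw [reducedField, ← hbv, ext0_apply _ v.2.2]
          rfl
      -- An odd coordinate pulls back to zero. Its image under X₀ is odd, so it has no body and
      -- pulls back to zero as well.
      · have hz : grBody q (gen r) = 0 := grBody_ι _
        have h1 : (A.pull W le_rfl (coord q W (.inr r))) = 0 := SuperFun.ext fun w => by
          rw [hA, bodyMor_apply]
          change algebraMap ℝ (Gr 0) (grBody q (gen r)) = 0
          rw [hz, map_zero]
        rw [← hA, h1, map_zero]
        have h2 := X.even.app_sInv_even le_rfl (coord q W (.inr r))
        rw [sInv_coord_inr, map_neg] at h2
        have h3 : grBody q ((X.even.app W le_rfl (coord q W (.inr r))).1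
            ⟨(b ⟨v.1, v.2.1⟩).1, v.2.2⟩) = 0 :=
          grBody_eq_zero_of_odd (congrArg (fun k : SuperFun q W => k.1 _) h2).symm
        rw [h3, map_zero]
        rfl)
  exact fun O hO f => sub_eq_zero.1 (key O hO f)

/-- **Existence of even flows** over the flow of the body. -/
theorem exists_evenFlow (X : SuperVectorField q W) (hb : IsFlowBody b β t₀)
    (hH : ContDiffOn ℝ ∞ H V) (hbH : ∀ v : V, (b v).1 = H v)
    (hflow : ∀ t x, (t, x) ∈ V → HasDerivAt (fun s => H (s, x)) (reducedField X (H (t, x))) t) :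
    ∀ {n : ℕ} (φ : MorOver n q β), ∃ F : MorOver n q b, IsEvenFlow X.even F ∧ HasInit hb F φ := by
  intro n
  induction n with
  | zero =>
    intro φ
    refine ⟨bodyMor q hH hbH, isEvenFlow_bodyMor X hH hbH hflow, fun O hO f x => ?_⟩
    rw [eq_algebraMap_grBody ((φ.pull O hO f).1 x), φ.grBody_pull, bodyMor_apply]
    have h0 : (b ⟨(t₀, x.1), hb.initial_mem _ x.2.1⟩).1 = (β ⟨x.1, x.2.1⟩).1 :=
      congrArg (fun y : W => y.1) (hb.initial ⟨x.1, x.2.1⟩)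
    have h1 : (⟨(b ⟨(t₀, x.1), hb.initial_mem _ x.2.1⟩).1, (hb.mem_preim x.2).2⟩ : O) =
        ⟨(β ⟨x.1, x.2.1⟩).1, x.2.2⟩ :=
      Subtype.ext h0
    exact congrArg (fun y : O => algebraMap ℝ (Gr 0) (grBody q (f.1 y))) h1
  | succ n ih =>
    intro φ
    obtain ⟨A, hA, hAφ⟩ := ih φ.kill
    exact exists_evenFlow_succ hb φ hA hAφ

theorem contDiffOn_reducedField (X : SuperVectorField q W) :
    ContDiffOn ℝ ∞ (reducedField X) W :=
  contDiffOn_pi.2 fun j => (LinearMap.toContinuousLinearMap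
    (grBody q).toLinearMap).contDiff.comp_contDiffOn (X.even.app W le_rfl (evenCoord q W j)).2

/-- The underlying map of an even flow is the flow of the body. -/
theorem IsEvenFlow.body_eq {X : SuperVectorField q W} (hb : IsFlowBody b β t₀)
    {A : MorOver n q b} (hA : IsEvenFlow X.even A)
    (hflow : ∀ t x, (t, x) ∈ V → HasDerivAt (fun s => H (s, x)) (reducedField X (H (t, x))) t)
    (hinit : ∀ x : U, H (t₀, x) = β x) (v : V) : (b v).1 = H v := by
  -- The map b is a priori only continuous. Its components are the bodies of the pulled-back even
  -- coordinates, which are smooth, and the body of the flow equation makes them an integral curve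
  -- of the reduced field in time.
  set f : ℝ × (Fin m → ℝ) → (Fin p → ℝ) := fun w j =>
    grBody n (ext0 (A.pull W le_rfl (evenCoord q W j)).1 w) with hf
  have hfb : ∀ w : V, f w = (b w).1 := by
    intro w
    have hw : w.1 ∈ preim b W := mem_preim_top w.2
    funext j
    simp only [hf]
    rw [ext0_apply _ hw, A.grBody_pull, evenCoord_apply, AlgHom.commutes]
    rfl
  have hxU : v.1.2 ∈ U := hb.mem_of_mem _ v.2
  have hI : IsOpen {t : ℝ | (t, v.1.2) ∈ V} := V.isOpen.preimage (by fun_prop)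
  have hder : ∀ t ∈ {t : ℝ | (t, v.1.2) ∈ V},
      HasDerivAt (fun s => f (s, v.1.2)) (reducedField X (f (t, v.1.2))) t := by
    intro t ht
    have htW : (t, v.1.2) ∈ preim b W := mem_preim_top ht
    refine hasDerivAt_pi.2 fun j => ?_
    have h1 := hasDerivAt_time (A.pull W le_rfl (evenCoord q W j)) ⟨(t, v.1.2), htW⟩
    have h2 := (LinearMap.toContinuousLinearMap
      (grBody n).toLinearMap).hasFDerivAt.comp_hasDerivAt t h1
    refine h2.congr_deriv ?_
    change grBody n ((timeDeriv _).1 _) = _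
    rw [hA, A.grBody_pull, reducedField, hfb ⟨_, ht⟩, ext0_apply _ (b ⟨_, ht⟩).2]
  have h0 : f (t₀, v.1.2) = H (t₀, v.1.2) := by
    rw [hfb ⟨_, hb.initial_mem _ hxU⟩, hb.initial ⟨_, hxU⟩, ← hinit]
  have h1 := autonomous_ode_unique hI (hb.interval _ hxU) W.isOpen
    ((contDiffOn_reducedField X).of_le (by simp)) (hb.initial_mem _ hxU)
    (f := fun s => f (s, v.1.2)) (g := fun s => H (s, v.1.2))
    (fun t ht => by rw [hfb ⟨_, ht⟩]; exact (b ⟨_, ht⟩).2) hder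
    (fun t ht => hflow t v.1.2 ht) h0 v.2
  rw [← hfb v]
  exact h1

end BodyFlow

/-! ### The weakened flow equation -/

section FlowEquation

variable {m n p q : ℕ} {U : Opens (Fin m → ℝ)} {W : Opens (Fin p → ℝ)}
  {V : Opens (ℝ × (Fin m → ℝ))} {b : C(V, W)} {β : C(U, W)} {t₀ : ℝ}

/-- The weakened flow equation in terms of the two components of a morphism. -/
theorem solvesFlowEq_iff {X : SuperVectorField q W} {F : MorOver (n + 1) q b} :
    SolvesFlowEq X F.toMor ↔ ∀ O hO f,
      timeDeriv (F.kill.pull O hO f) + F.top.app O hO f = F.kill.pull O hO (X.app O hO f) := by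
  refine forall_congr' fun O => forall_congr' fun hO => forall_congr' fun f => ?_
  -- Applying ∂_τ and then setting τ = 0 is by definition `top`, while ∂_t commutes with setting τ =
  -- 0.
  have h1 : ∀ v : preim b O, kill n ((derivTTau _ (F.pull O hO f)).1 v) =
      (timeDeriv (F.kill.pull O hO f) + F.top.app O hO f).1 v := by
    intro v
    have h2 : timeDeriv (F.kill.pull O hO f) = mapGr (kill n).toLinearMap
      (timeDeriv (F.pull O hO f)) := evenDeriv_mapGr _ (kill n).toLinearMap _
    rw [h2]
    exact map_add (kill n) _ _
  constructor
  · intro h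
    refine SuperFun.ext fun v => ?_
    rw [← h1]
    exact congrArg (fun k : SuperFun n (preim (injTau n V).body (preim b O)) =>
      k.1 ⟨v.1, v.2.1, v.2⟩) h
  · intro h
    refine SuperFun.ext fun v => ?_
    exact (h1 ⟨v.1, v.2.2⟩).trans
      (congrArg (fun k : SuperFun n (preim b O) => k.1 ⟨v.1, v.2.2⟩) h)

/-- For a morphism with the weakened flow equation, the restriction to `τ = 0` is an even flow,
and the coefficient of `τ` is the odd part of the vector field. -/
theorem isEvenFlow_kill_and_top_eq {X : SuperVectorField q W} {F : MorOver (n + 1) q b}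
    (hF : SolvesFlowEq X F.toMor) :
    IsEvenFlow X.even F.kill ∧
      ∀ O hO f, F.top.app O hO f = F.kill.pull O hO (X.odd.app O hO f) := by
  rw [solvesFlowEq_iff] at hF
  have key : ∀ O hO f, timeDeriv (F.kill.pull O hO f) = F.kill.pull O hO (X.even.app O hO f) := by
    intro O hO f
    have h1 := hF O hO f
    -- Conjugation by the grade involution preserves the even terms ∂_t A and A ∘ X₀ and reverses
    -- the odd terms D and A ∘ X₁. Adding both equations therefore isolates the even part, up to the
    -- factor 2.
    have h2 := congrArg sInv (hF O hO (sInv f))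
    have h3 : ∀ k : SuperFun n (preim b O), timeDeriv (sInv k) = sInv (timeDeriv k) :=
      fun k => evenDeriv_sInv _ k
    have h4 : ∀ g, X.app O hO g = X.even.app O hO g + X.odd.app O hO g := fun g => rfl
    rw [h4, map_add] at h1 h2
    rw [F.kill.pull_sInv, h3, F.isOddDer_top.map_sInv, X.even.app_sInv_even, X.odd.app_sInv_odd,
      map_neg, map_add, map_neg, F.kill.pull_sInv, F.kill.pull_sInv, map_add, map_neg, sInv_sInv,
      sInv_sInv, sInv_sInv, sInv_sInv] at h2
    have h5 : (2 : ℝ) • timeDeriv (F.kill.pull O hO f) =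
        (2 : ℝ) • F.kill.pull O hO (X.even.app O hO f) := by
      rw [two_smul, two_smul]
      have h6 := congrArg₂ (· + ·) h1 h2
      calc _ = timeDeriv (F.kill.pull O hO f) + F.top.app O hO f +
            (timeDeriv (F.kill.pull O hO f) + -F.top.app O hO f) := by abel
        _ = _ := h6
        _ = _ := by abel
    exact smul_right_injective _ two_ne_zero h5
  refine ⟨key, fun O hO f => ?_⟩
  have h1 := hF O hO f
  have h4 : X.app O hO f = X.even.app O hO f + X.odd.app O hO f := rfl
  rw [h4, map_add, key] at h1
  exact add_left_cancel h1

/-- The odd derivation `A ∘ X₁` along a morphism `A`. -/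
def oddPart (X : SuperDer q 1 W) (A : MorOver n q b) : LinOver n q b where
  app O hO := (A.pull O hO).toLinearMap ∘ₗ X.app O hO
  natural O₁ O₂ h₁ h₂ h f := by
    simp only [LinearMap.comp_apply, AlgHom.toLinearMap_apply]
    rw [A.natural O₁ O₂ h₁ h₂ h, X.natural O₁ O₂ h₁ h₂ h]

theorem isOddDer_oddPart (X : SuperDer q 1 W) (A : MorOver n q b) :
    IsOddDer A (oddPart X A) where
  leibniz O hO f g := by
    change A.pull O hO (X.app O hO (f * g)) = A.pull O hO (X.app O hO f) * _ +
      _ * A.pull O hO (X.app O hO g)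
    rw [X.app_mul_odd, map_add, map_mul, map_mul]
  map_sInv O hO f := by
    change A.pull O hO (X.app O hO (sInv f)) = -sInv (A.pull O hO (X.app O hO f))
    rw [X.app_sInv_odd, map_neg, A.pull_sInv]

theorem solvesFlowEq_glue {X : SuperVectorField q W} {A : MorOver n q b}
    (hA : IsEvenFlow X.even A) :
    SolvesFlowEq X (A.glue _ (isOddDer_oddPart X.odd A)).toMor := by
  rw [solvesFlowEq_iff]
  intro O hO f
  rw [MorOver.kill_glue, MorOver.top_glue, hA]
  exact (map_add (A.pull O hO) _ _).symm

theorem hasInit_of_comp_eq {F : MorOver (n + 1) q b} {φ : MorOver n q β}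
    (hb : IsFlowBody b β t₀)
    (h : F.toMor.comp (injTime n V t₀ hb.initial_mem) = φ.toMor) : HasInit hb F.kill φ := by
  -- The composite and φ have pull-backs of different types until their bodies are identified.
  -- Generalizing the right-hand side to G allows the equality to be substituted.
  have key : ∀ G : SuperMor n q U W, F.toMor.comp (injTime n V t₀ hb.initial_mem) = G →
      ∀ O hO f x (hx : x ∈ preim G.body O) (hx' : (t₀, x) ∈ preim b O),
        (F.kill.pull O hO f).1 ⟨(t₀, x), hx'⟩ = (G.pull O hO f).1 ⟨x, hx⟩ := by
    rintro G rfl O hO f x hx hx'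
    rfl
  exact fun O hO f x => key _ h O hO f x.1 x.2 _

/-- Pull-backs are compared by their values at points, which makes sense even before their types are
identified through the equality of the bodies. -/
theorem superMor_ext {G₁ G₂ : SuperMor n q U W} (hbody : G₁.body = G₂.body)
    (h : ∀ O hO f x (h₁ : x ∈ preim G₁.body O) (h₂ : x ∈ preim G₂.body O),
      (G₁.pull O hO f).1 ⟨x, h₁⟩ = (G₂.pull O hO f).1 ⟨x, h₂⟩) : G₁ = G₂ := by
  obtain ⟨b₁, pull₁, par₁, nat₁⟩ := G₁
  obtain ⟨b₂, pull₂, par₂, nat₂⟩ := G₂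
  obtain rfl : b₁ = b₂ := hbody
  have h1 : pull₁ = pull₂ := funext fun O => funext fun hO => AlgHom.ext fun f =>
    SuperFun.ext fun x => h O hO f x.1 x.2 x.2
  subst h1
  rfl

theorem comp_eq_of_hasInit {F : MorOver (n + 1) q b} {φ : MorOver n q β}
    (hb : IsFlowBody b β t₀) (h : HasInit hb F.kill φ) :
    F.toMor.comp (injTime n V t₀ hb.initial_mem) = φ.toMor :=
  superMor_ext (ContinuousMap.ext fun x => hb.initial x) fun O hO f x _ h₂ =>
    h O hO f ⟨x, h₂⟩

end FlowEquation

end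

end SuperFlow

/-! ### Assembly: existence, uniqueness and the underlying map -/

theorem mainTheorem5 {m n p q : ℕ}
    (U : TopologicalSpace.Opens (Fin m → ℝ)) (W : TopologicalSpace.Opens (Fin p → ℝ))
    (X : SuperFlow.SuperVectorField q W) (φ : SuperFlow.SuperMor n q U W) (t₀ : ℝ)
    (V : TopologicalSpace.Opens (ℝ × (Fin m → ℝ))) (H : ℝ × (Fin m → ℝ) → (Fin p → ℝ))
    (hH : SuperFlow.IsMaximalFlow (SuperFlow.reducedField X) φ.body t₀ V H) :
    (∃! F : SuperFlow.SuperMor (n + 1) q V W,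
      SuperFlow.SolvesFlowEq X F ∧
        F.comp (SuperFlow.injTime n V t₀ hH.1.initial_mem) = φ) ∧
    ∀ F : SuperFlow.SuperMor (n + 1) q V W,
      SuperFlow.SolvesFlowEq X F →
      F.comp (SuperFlow.injTime n V t₀ hH.1.initial_mem) = φ →
      ∀ v : V, (F.body v : Fin p → ℝ) = H v := by
  have hflow := hH.1
  have hbody : ∀ F : SuperFlow.SuperMor (n + 1) q V W, SuperFlow.SolvesFlowEq X F →
      F.comp (SuperFlow.injTime n V t₀ hH.1.initial_mem) = φ →
      ∀ v : V, (F.body v : Fin p → ℝ) = H v := by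
    intro F hF hφ v
    have hb : SuperFlow.IsFlowBody F.body φ.body t₀ :=
      ⟨hflow.mem_of_mem, hflow.initial_mem, hflow.interval, fun x =>
        congrArg (fun G : SuperFlow.SuperMor n q U W => G.body x) hφ⟩
    -- The equations are used over the body of F itself. The classical uniqueness theorem for the
    -- reduced field then forces this body to be H.
    exact (SuperFlow.isEvenFlow_kill_and_top_eq (F := F.over) hF).1.body_eq hb hflow.flow
      hflow.initial v
  refine ⟨?_, hbody⟩
  set b : C(V, W) := ⟨fun v => ⟨H v, hflow.mapsTo v.2⟩,
    (continuousOn_iff_continuous_domRestrict.mp hflow.smooth.continuousOn).subtype_mk _⟩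
  have hb : SuperFlow.IsFlowBody b φ.body t₀ :=
    ⟨hflow.mem_of_mem, hflow.initial_mem, hflow.interval, fun x => Subtype.ext (hflow.initial x)⟩
  obtain ⟨A, hA, hAφ⟩ := SuperFlow.exists_evenFlow X hb hflow.smooth (fun _ => rfl) hflow.flow
    φ.over
  -- Given the even flow A, the coefficient of τ can only be A ∘ X₁.
  set F := A.glue _ (SuperFlow.isOddDer_oddPart X.odd A) with hFdef
  have hFk : F.kill = A := SuperFlow.MorOver.kill_glue _ _ _
  refine ⟨F.toMor, ⟨SuperFlow.solvesFlowEq_glue hA,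
    SuperFlow.comp_eq_of_hasInit hb (by rw [hFk]; exact hAφ)⟩, ?_⟩
  rintro G ⟨hG, hGφ⟩
  -- Any solution G has body H by the preceding argument, so it lies over the same b as F. Then its
  -- restriction at τ = 0 is A by uniqueness of even flows, and its coefficient of τ is A ∘ X₁.
  obtain ⟨G, rfl⟩ := G.exists_toMor_eq (b := b)
    (ContinuousMap.ext fun v => Subtype.ext (hbody G hG hGφ v))
  obtain ⟨hGe, hGt⟩ := SuperFlow.isEvenFlow_kill_and_top_eq hG
  have hGinit : SuperFlow.HasInit hb G.kill φ.over := SuperFlow.hasInit_of_comp_eq hb hGφ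
  have hk : G.kill = A := SuperFlow.IsEvenFlow.unique hb hGe hA hGinit hAφ
  refine congrArg SuperFlow.MorOver.toMor (SuperFlow.MorOver.ext_of_kill_top (hk.trans hFk.symm) ?_)
  rw [hFdef, SuperFlow.MorOver.top_glue]
  refine SuperFlow.LinOver.ext (funext fun O => funext fun hO => LinearMap.ext fun f => ?_)
  rw [hGt, hk]
  rfl
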